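/- Let $n\ge 1$, put $m=\lfloor n/2\rfloor$, and let $\mathbb k$ be a commutative ring with a chosen element $\sqrt n$ satisfying $(\sqrt n)^2=n$. **Ribbon graphs.** A trivalent ribbon graph $\Gamma$ (loops, multiple edges and vertexless edges allowed) is presented by a signed rotation system: a finite set of half-edges, three at each vertex $v\in V$, a cyclic order of the half-edges at each vertex, a pairing of the half-edges into edges, and a sign for each edge (a negative edge is a band with a half-twist). Two presentations are equivalent if they agree up to isomorphism of the underlying graphs and flips of vertices (a flip reverses the cyclic order at a vertex and changes the sign of each incident edge once for each of its ends there). Ribbon graphs are the equivalence classes. **States.** In the bubbled blowup $\Gamma^B$ every vertex is replaced by a cycle and every edge by two matching edges (one for each half-edge) with a 2-cycle between them. A state $\alpha$ of $\Gamma^B$ replaces each matching edge by two parallel arcs ($0$-smoothing) or two crossing arcs ($1$-smoothing), which gives $k_\alpha$ circles. A vertex state $\nu\in\{0,1\}^V$ is the state of $\Gamma^B$ that uses the $\nu_v$-smoothing at the three matching edges of each vertex $v$; let $k_\nu$ be its number of circles and $|\nu|=\sum_v\nu_v$. **Maps.** Let $A=\mathbb k[x]/(x^n)$, graded by $\deg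 x^a=m-a$. To an edge of the hypercube of states of $\Gamma^B$ (one smoothing changes from $0$ to $1$) assign the map $A^{\otimes k_\alpha}\to A^{\otimes k_{\alpha'}}$ that is the identity on the unaffected circles and, on the affected ones, is the multiplication of $A$ if two circles merge, $\Delta(x^l)=\sum_{i+j=l+2m,\ 0\le i,j<n}x^i\otimes x^j$ if one circle splits, and $\eta(x^l)=\sqrt n\,x^{l+m}$ if one circle remains one circle. **Complex.** Let $C_n^{i,*}(\Gamma)=\bigoplus_{|\nu|=i}A^{\otimes k_\nu}\{3m|\nu|\}$, where $\{\ell\}$ raises degrees by $\ell$. Number the vertices. For vertex states $\nu\to\nu'$ that differ only at $v$, with $\nu_v=0$ and $\nu'_v=1$, let $\delta_{\nu\nu'}$ be the composite of the three maps along a three-edge path from $\nu$ to $\nu'$ in the hypercube of $\Gamma^B$. Let $\delta$ be the sum of the maps $(-1)^{\#\{u<v\,:\,\nu_u=1\}}\,\delta_{\nu\nu'}$. **Polynomial.** The $n$-color vertex polynomial is $$\langle\!\langle\Gamma\rangle\!\rangle_n=\sum_{\nu\in\{0,1\}^V}(-q^{3m})^{|\nu|}\,(q^m+q^{m-1}+\dots+q^{m-n+1})^{k_\nu}.$$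 **Theorem 1.** 1. $\delta_{\nu\nu'}$ does not depend on the choice among the six three-edge paths; $\delta$ has bidegree $(1,0)$ and $\delta^2=0$. Hence the bigraded $n$-color vertex homology $VCH_n^{i,j}(\Gamma;\mathbb k)=\ker(\delta|_{C_n^{i,j}})/\delta(C_n^{i-1,j})$ is well defined. 2. Up to isomorphism of $\mathbb k$-modules in each bidegree, $VCH_n^{*,*}(\Gamma;\mathbb k)$ depends neither on the numbering of the vertices nor on the presentation: it is an invariant of the ribbon graph $\Gamma$. 3. Its graded Euler characteristic is the $n$-color vertex polynomial, $\chi_q(VCH_n^{*,*}(\Gamma;\mathbb k))=\langle\!\langle\Gamma\rangle\!\rangle_n$. That is, if $\mathbb k$ is an integral domain, $\sum_{i,j}(-1)^iq^j\,\mathrm{rank}_{\mathbb k}VCH_n^{i,j}(\Gamma;\mathbb k)=\langle\!\langle\Gamma\rangle\!\rangle_n$. For arbitrary $\mathbb k$, let $r$ be any function from $\mathbb k$-modules to an abelian group that is additive on short exact sequences whose middle term is a subquotient of a free module of finite rank; then for every $j$, $\sum_i(-1)^i\,r(VCH_n^{i,j}(\Gamma;\mathbb k))$ equals the coefficient of $q^j$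 in $\langle\!\langle\Gamma\rangle\!\rangle_n$ times $r(\mathbb k)$. -/

import Mathlib

open scoped LaurentPolynomial

/-! ## Perfect matching graphs and the hypercube of their states -/

/-- The combinatorial data of a (trivalent) perfect matching ribbon graph that the smoothings of its
matching edges use.  `M` is the set of matching edges.  A matching edge `e` is a band with two
ends `i : Bool`; at the endpoint at end `i` there are two further half-edges, one on each side
`b : Bool` of the band, and `(e, i, b)` denotes this half-edge (sides at the two ends are matched
along the band, i.e. `(e, false, b)` and `(e, true, b)` lie on the same side of it).  Non-matching
edges join these half-edges in pairs by `join`.  `F` is the set of circles without vertices. -/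
structure PerfectMatchingGraph (M F : Type) where
  join : M × Bool × Bool → M × Bool × Bool
  join_join : ∀ p, join (join p) = p
  join_ne : ∀ p, join p ≠ p

namespace PerfectMatchingGraph

variable {M F : Type}

/-- The points through which the circles of a state are recorded. -/
abbrev Point (_D : PerfectMatchingGraph M F) : Type := (M × Bool × Bool) ⊕ F

/-- The arcs of the state `α`: the non-matching edges, and at each matching edge `e` two arcs running
along the band, parallel for the `0`-smoothing and crossing for the `1`-smoothing. -/
inductive Arc (D : PerfectMatchingGraph M F) (α : M → Bool) : D.Point → D.Point → Prop
  | join (p : M × Bool × Bool) : Arc D α (Sum.inl p) (Sum.inl (D.join p))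
  | smoothing (e : M) (b : Bool) :
      Arc D α (Sum.inl (e, false, b)) (Sum.inl (e, true, xor b (α e)))

/-- The (immersed) circles of the state `α`. -/
def Circle (D : PerfectMatchingGraph M F) (α : M → Bool) : Type := Quot (D.Arc α)

/-- The circle of the state `α` through a point. -/
def circ (D : PerfectMatchingGraph M F) (α : M → Bool) (p : D.Point) : D.Circle α := Quot.mk _ p

instance (D : PerfectMatchingGraph M F) [Finite M] [Finite F] (α : M → Bool) :
    Finite (D.Circle α) :=
  Finite.of_surjective (D.circ α) Quot.mk_surjective

/-- The monomial basis of `⨁_α V^{⊗ k_α}`, where `V = 𝕜[x]/(xⁿ)` and `k_α` is the number of circles of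
the state `α`: a pair `⟨α, a⟩` stands for the monomial `⨂_c x^{a c}` of `V^{⊗ k_α}`. -/
abbrev Monomial (D : PerfectMatchingGraph M F) (n : ℕ) : Type :=
  (α : M → Bool) × (D.Circle α → Fin n)

noncomputable instance (D : PerfectMatchingGraph M F) [Finite M] [Finite F] (n : ℕ) :
    Fintype (D.Monomial n) := Fintype.ofFinite _

end PerfectMatchingGraph

section LocalMaps

variable {k : Type*} [CommRing k]

/-- The coefficient of `xˡ` in `m(xⁱ ⊗ xʲ) = x^{i+j}` (and `= 0` if `i + j ≥ n`). -/
def mulCoeff (k : Type*) [CommRing k] {n : ℕ} (i j l : Fin n) : k :=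
  if (l : ℕ) = i + j then 1 else 0

/-- The coefficient of `xⁱ ⊗ xʲ` in `Δ(xˡ) = ∑_{i + j = l + 2m} xⁱ ⊗ xʲ`, with `m = ⌊n/2⌋`. -/
def comulCoeff (k : Type*) [CommRing k] {n : ℕ} (l i j : Fin n) : k :=
  if (i : ℕ) + j = l + 2 * (n / 2) then 1 else 0

/-- The coefficient of `xʲ` in `η(xⁱ) = √n x^{i+m}` (and `= 0` if `i + m ≥ n`), with `m = ⌊n/2⌋`;
the chosen square root of `n` is `s`. -/
def etaCoeff {n : ℕ} (s : k) (i j : Fin n) : k :=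
  if (j : ℕ) = i + n / 2 then s else 0

end LocalMaps

namespace PerfectMatchingGraph

variable {M F : Type} {k : Type*} [CommRing k]

open Classical in
/-- The matrix entry, from the monomial `x = ⟨α, a⟩` to the monomial `y = ⟨α', a'⟩`, of the sum
of all (unsigned) maps of the edges `α → α'` of the hypercube which change the smoothing of the
matching edge `e` from `0` to `1`.  The map is the identity on the circles not running through
`e`.  On the circles through `e` it is `m` if there are two of them in `α`, `Δ` if there is
one in `α` and two in `α'`, and `η` if there is one in both. -/
noncomputable def edgeCoeff (D : PerfectMatchingGraph M F) {n : ℕ} (s : k) (e : M)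
    (x y : D.Monomial n) : k :=
  let c₀ := D.circ x.1 (Sum.inl (e, false, false))
  let c₁ := D.circ x.1 (Sum.inl (e, false, true))
  let d₀ := D.circ y.1 (Sum.inl (e, false, false))
  let d₁ := D.circ y.1 (Sum.inl (e, false, true))
  if x.1 e = false ∧ y.1 e = true ∧ (∀ e', e' ≠ e → y.1 e' = x.1 e') ∧
      ∀ p, D.circ x.1 p ≠ c₀ → D.circ x.1 p ≠ c₁ → y.2 (D.circ y.1 p) = x.2 (D.circ x.1 p) then
    if c₀ ≠ c₁ then mulCoeff k (x.2 c₀) (x.2 c₁) (y.2 d₀)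
    else if d₀ ≠ d₁ then comulCoeff k (x.2 c₀) (y.2 d₀) (y.2 d₁)
    else etaCoeff s (x.2 c₀) (y.2 d₀)
  else 0

/-- The sum of the (unsigned) maps of all edges of the hypercube of states in the direction of the
matching edge `e`.  Vectors of `⨁_α V^{⊗ k_α}` are given by their coordinates in the monomial
basis. -/
noncomputable def edgeMap (D : PerfectMatchingGraph M F) [Finite M] [Finite F] (n : ℕ) (s : k)
    (e : M) : (D.Monomial n → k) →ₗ[k] (D.Monomial n → k) :=
  Matrix.mulVecLin (Matrix.of fun y x => D.edgeCoeff s e x y)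

end PerfectMatchingGraph

/-! ## Trivalent ribbon graphs -/

/-- A trivalent ribbon graph with vertex set `V`, presented by a signed rotation system: `H` is the
set of half-edges, `vert` the vertex of a half-edge, `rot` the cyclic (counterclockwise) order of
the half-edges at each vertex, `opp` the involution whose orbits are the edges, and `twist` tells
which edges are negative (have a half-twist in their band).  `L` is the set of vertexless edges
(circles), `loopTwist` tells which of them are negative. -/
structure TrivalentRibbonGraph (V H L : Type) where
  vert : H → V
  rot : Equiv.Perm H
  opp : H → H
  twist : H → Bool
  loopTwist : L → Bool
  vert_eq_iff : ∀ h h', vert h = vert h' ↔ rot.SameCycle h h'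
  trivalent : ∀ v, Nat.card {h // vert h = v} = 3
  opp_opp : ∀ h, opp (opp h) = h
  opp_ne : ∀ h, opp h ≠ h
  twist_opp : ∀ h, twist (opp h) = twist h

namespace TrivalentRibbonGraph

variable {V H L V' H' L' : Type}

/-- Equivalence of ribbon graphs in terms of signed rotation systems: an isomorphism of the
underlying graphs such that, after flipping the discs of some of the vertices (`flip`), the
cyclic orders agree.  Flipping a vertex reverses its cyclic order and changes the sign of
each incident edge once for each of its ends at that vertex. -/
structure Equivalence (Γ : TrivalentRibbonGraph V H L) (Γ' : TrivalentRibbonGraph V' H' L') where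
  onVert : V ≃ V'
  onHalf : H ≃ H'
  onLoop : L ≃ L'
  flip : V → Bool
  map_vert : ∀ h, Γ'.vert (onHalf h) = onVert (Γ.vert h)
  map_opp : ∀ h, Γ'.opp (onHalf h) = onHalf (Γ.opp h)
  map_rot : ∀ h, flip (Γ.vert h) = false → Γ'.rot (onHalf h) = onHalf (Γ.rot h)
  map_rot_flip : ∀ h, flip (Γ.vert h) = true → Γ'.rot (onHalf (Γ.rot h)) = onHalf h
  map_twist : ∀ h, Γ'.twist (onHalf h) =
    xor (Γ.twist h) (xor (flip (Γ.vert h)) (flip (Γ.vert (Γ.opp h))))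
  map_loopTwist : ∀ l, Γ'.loopTwist (onLoop l) = Γ.loopTwist l

/-- The circles without vertices of the diagrams: the boundary circles of the annulus (two of them) or
Möbius band (one) given by each vertexless edge. -/
abbrev FreeCircle (Γ : TrivalentRibbonGraph V H L) : Type :=
  {c : L × Bool // c.2 = true → Γ.loopTwist c.1 = false}

/-- How the non-matching edges of the bubbled blowup join up, see `bubbledBlowup`. -/
def bubbleJoin (Γ : TrivalentRibbonGraph V H L) : H × Bool × Bool → H × Bool × Bool
  | (h, false, true) => (Γ.rot h, false, false)
  | (h, false, false) => (Γ.rot.symm h, false, true)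
  | (h, true, b) => (Γ.opp h, true, xor (!b) (Γ.twist h))

/-- The bubbled blowup `Γ^B`.  Every vertex is replaced by a cycle and every edge by two matching
edges with a `2`-cycle (bubble) in between, so that there is one matching edge for every
half-edge `h` of `Γ`.  Its end `false` is at the vertex of `h` and its end `true` is at the
bubble.  Looking out from the vertex, its side `true` faces the next half-edge `rot h` and
its side `false` the previous one.  A half-twist of an edge is put into its bubble. -/
def bubbledBlowup (Γ : TrivalentRibbonGraph V H L) : PerfectMatchingGraph H Γ.FreeCircle where
  join := Γ.bubbleJoin
  join_join := by
    rintro ⟨h, _ | _, _ | _⟩ <;> cases ht : Γ.twist h <;>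
      simp [bubbleJoin, Γ.opp_opp, Γ.twist_opp, ht]
  join_ne := by
    rintro ⟨h, _ | _, b⟩
    · cases b <;> simp [bubbleJoin]
    · simp [bubbleJoin, Γ.opp_ne]

/-! ## The hypercube of vertex states -/

/-- The state of the bubbled blowup corresponding to a vertex state `ν`: the vertex `0`-smoothing
(`1`-smoothing) at `v` is the `0`-smoothing (`1`-smoothing) of the three matching edges at `v`. -/
def blowupState (Γ : TrivalentRibbonGraph V H L) (ν : V → Bool) : H → Bool := fun h => ν (Γ.vert h)

/-- The circles of the vertex state `Γ_ν`. -/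
abbrev StateCircle (Γ : TrivalentRibbonGraph V H L) (ν : V → Bool) : Type :=
  Γ.bubbledBlowup.Circle (Γ.blowupState ν)

/-- The monomial basis of `⨁_ν V^{⊗ k_ν}`, the sum over all vertex states `ν`. -/
abbrev VertexMonomial (Γ : TrivalentRibbonGraph V H L) (n : ℕ) : Type :=
  (ν : V → Bool) × (Γ.StateCircle ν → Fin n)

/-- A monomial over a vertex state as a monomial over a state of the bubbled blowup. -/
def toBlowup (Γ : TrivalentRibbonGraph V H L) (n : ℕ) (x : Γ.VertexMonomial n) :
    Γ.bubbledBlowup.Monomial n := ⟨Γ.blowupState x.1, x.2⟩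

/-- The number `|ν|` of vertex `1`-smoothings. -/
noncomputable def weight (ν : V → Bool) : ℕ := Nat.card {v // ν v = true}

/-- The homological degree `|ν|` of a monomial. -/
noncomputable def homDegree (Γ : TrivalentRibbonGraph V H L) {n : ℕ} (x : Γ.VertexMonomial n) : ℤ :=
  weight x.1

/-- The quantum degree of a monomial: `x^a ∈ V` has degree `m - a`, where `m = ⌊n/2⌋`, degrees add
up in tensor products, and the summand of `ν` is shifted by `3m|ν|`. -/
noncomputable def qDegree (Γ : TrivalentRibbonGraph V H L) [Finite H] [Finite L] {n : ℕ}
    (x : Γ.VertexMonomial n) : ℤ :=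
  letI := Fintype.ofFinite (Γ.StateCircle x.1)
  (∑ c, ((n / 2 : ℕ) - (x.2 c : ℕ) : ℤ)) + 3 * (n / 2 : ℕ) * (weight x.1 : ℤ)

section Homology

variable {k : Type*} [CommRing k]

/-- The chain group `C_n^{i,j}(Γ)`, spanned by the monomials of bidegree `(i, j)`. -/
def chain (Γ : TrivalentRibbonGraph V H L) [Finite H] [Finite L] (n : ℕ) (k : Type*) [CommRing k]
    (i j : ℤ) : Submodule k (Γ.VertexMonomial n → k) where
  carrier := {w | ∀ x, ¬ (Γ.homDegree x = i ∧ Γ.qDegree x = j) → w x = 0}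
  add_mem' := by
    intro a b ha hb x hx
    simp [ha x hx, hb x hx]
  zero_mem' := by
    intro x _
    rfl
  smul_mem' := by
    intro c a ha x hx
    simp [ha x hx]

/-- The composite of the maps of three successive edges of the hypercube of states of the bubbled
blowup, changing the smoothings of the matching edges `h₁`, `h₂`, `h₃` in this order, from the
vertex states to the vertex states. -/
noncomputable def threeStep (Γ : TrivalentRibbonGraph V H L) [Finite H] [Finite L] (n : ℕ) (s : k)
    (h₁ h₂ h₃ : H) : (Γ.VertexMonomial n → k) →ₗ[k] (Γ.VertexMonomial n → k) :=
  LinearMap.funLeft k k (Γ.toBlowup n) ∘ₗ Γ.bubbledBlowup.edgeMap n s h₃ ∘ₗ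
    Γ.bubbledBlowup.edgeMap n s h₂ ∘ₗ Γ.bubbledBlowup.edgeMap n s h₁ ∘ₗ
    Function.ExtendByZero.linearMap k (Γ.toBlowup n)

theorem exists_vert_eq (Γ : TrivalentRibbonGraph V H L) (v : V) : ∃ h, Γ.vert h = v := by
  by_contra hv
  have : IsEmpty {h // Γ.vert h = v} := ⟨fun h => hv ⟨h.1, h.2⟩⟩
  have h3 := Γ.trivalent v
  simp at h3

/-- The sum of the maps `δ_{νν'}` of all edges `ν → ν'` of the hypercube of vertex states in the
direction of the vertex `v`: the composite along one of the three-edge paths. -/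
noncomputable def vertexMap (Γ : TrivalentRibbonGraph V H L) [Finite H] [Finite L] (n : ℕ) (s : k)
    (v : V) : (Γ.VertexMonomial n → k) →ₗ[k] (Γ.VertexMonomial n → k) :=
  let h := (Γ.exists_vert_eq v).choose
  Γ.threeStep n s h (Γ.rot h) (Γ.rot (Γ.rot h))

/-- The sign of the edge of the hypercube of vertex states with tail `ν` in the direction of `v`:
`-1` to the number of `1`s to the left of `⋆`, where `o` is the numbering of the vertices. -/
noncomputable def edgeSign {N : ℕ} (o : V ≃ Fin N) (ν : V → Bool) (v : V) : ℤ :=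
  (-1) ^ Nat.card {u // o u < o v ∧ ν u = true}

/-- The differential `δ(w) = ∑_ρ sign(ρ) δ_{νν'}(w)` of the vertex homology. -/
noncomputable def differential (Γ : TrivalentRibbonGraph V H L) [Fintype V] [Finite H] [Finite L]
    (n : ℕ) (s : k) {N : ℕ} (o : V ≃ Fin N) :
    (Γ.VertexMonomial n → k) →ₗ[k] (Γ.VertexMonomial n → k) :=
  ∑ v, Γ.vertexMap n s v ∘ₗ
    LinearMap.pi fun x => (edgeSign o x.1 v : ℤ) • LinearMap.proj (R := k) (φ := fun _ => k) x

/-- The cocycles of bidegree `(i, j)`. -/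
noncomputable def cocycles (Γ : TrivalentRibbonGraph V H L) [Fintype V] [Finite H] [Finite L]
    (n : ℕ) (s : k) {N : ℕ} (o : V ≃ Fin N) (i j : ℤ) : Submodule k (Γ.VertexMonomial n → k) :=
  Γ.chain n k i j ⊓ LinearMap.ker (Γ.differential n s o)

/-- The coboundaries of bidegree `(i, j)`. -/
noncomputable def coboundaries (Γ : TrivalentRibbonGraph V H L) [Fintype V] [Finite H] [Finite L]
    (n : ℕ) (s : k) {N : ℕ} (o : V ≃ Fin N) (i j : ℤ) : Submodule k (Γ.VertexMonomial n → k) :=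
  (Γ.chain n k (i - 1) j).map (Γ.differential n s o)

/-- The bigraded `n`-color vertex homology `VCH_n^{i,j}(Γ; k)`. -/
abbrev VCH (Γ : TrivalentRibbonGraph V H L) [Fintype V] [Finite H] [Finite L]
    (n : ℕ) (s : k) {N : ℕ} (o : V ≃ Fin N) (i j : ℤ) : Type _ :=
  Γ.cocycles n s o i j ⧸ (Γ.coboundaries n s o i j).submoduleOf (Γ.cocycles n s o i j)

end Homology

/-! ## The `n`-color vertex polynomial -/

/-- The loop polynomial `q^m + q^{m-1} + ⋯ + q^{m-n+1}`, with `m = ⌊n/2⌋`. -/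
noncomputable def loopPolynomial (n : ℕ) : ℤ[T;T⁻¹] :=
  ∑ a ∈ Finset.range n, LaurentPolynomial.T ((n / 2 : ℕ) - a : ℤ)

open Classical in
/-- The vertex bracket of the vertex ribbon diagram with some of its vertices already smoothed:
`μ v` is the smoothing done at `v`, or `none` if there is still a dot at `v`.  This is the state
sum; see `vertexBracket_smooth` and `vertexBracket_circles` for the rules characterizing it. -/
noncomputable def vertexBracket (Γ : TrivalentRibbonGraph V H L) [Fintype V] (n : ℕ)
    (μ : V → Option Bool) : ℤ[T;T⁻¹] :=
  ∑ ν : V → Bool, if ∀ v b, μ v = some b → ν v = b then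
    (-LaurentPolynomial.T (3 * (n / 2 : ℕ) : ℤ)) ^ (Nat.card {v // μ v = none ∧ ν v = true}) *
      loopPolynomial n ^ Nat.card (Γ.StateCircle ν)
  else 0

open Classical in
/-- The bracket rule at a dotted vertex. -/
theorem vertexBracket_smooth (Γ : TrivalentRibbonGraph V H L) [Fintype V] (n : ℕ)
    (μ : V → Option Bool) (v : V) (hv : μ v = none) :
    Γ.vertexBracket n μ = Γ.vertexBracket n (Function.update μ v (some false)) -
      LaurentPolynomial.T (3 * (n / 2 : ℕ) : ℤ) *
        Γ.vertexBracket n (Function.update μ v (some true)) := by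
  have key : ∀ (b : Bool) (ν : V → Bool),
      (∀ u c, Function.update μ v (some b) u = some c → ν u = c) ↔
        ((∀ u c, μ u = some c → ν u = c) ∧ ν v = b) := by
    intro b ν
    constructor
    · intro h
      refine ⟨fun u c hu => h u c ?_, h v b (by simp)⟩
      have huv : u ≠ v := by
        rintro rfl
        simp [hv] at hu
      simpa [Function.update_of_ne huv] using hu
    · rintro ⟨h, hb⟩ u c hu
      by_cases huv : u = v
      · subst huv
        simp at hu
        exact hb.trans hu
      · exact h u c (by simpa [Function.update_of_ne huv] using hu)
  unfold vertexBracket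
  rw [Finset.mul_sum, ← Finset.sum_sub_distrib]
  refine Finset.sum_congr rfl fun ν _ => ?_
  simp only [key]
  by_cases hc : ∀ u c, μ u = some c → ν u = c
  · cases hb : ν v
    · have hs : Nat.card {u // μ u = none ∧ ν u = true} =
          Nat.card {u // Function.update μ v (some false) u = none ∧ ν u = true} := by
        refine Nat.card_congr (Equiv.subtypeEquivRight fun u => ?_)
        by_cases huv : u = v
        · subst huv
          simp [hb]
        · simp [Function.update_of_ne huv]
      rw [if_pos hc, if_pos ⟨hc, rfl⟩, if_neg (by simp), hs]
      simp
    · have hs : Nat.card {u // μ u = none ∧ ν u = true} =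
          Nat.card {u // Function.update μ v (some true) u = none ∧ ν u = true} + 1 := by
        rw [Nat.card_eq_fintype_card, Nat.card_eq_fintype_card, Fintype.card_subtype,
          Fintype.card_subtype, ← Finset.card_insert_of_notMem (a := v) (by simp)]
        congr 1
        ext u
        by_cases huv : u = v
        · subst huv
          simp [hb, hv]
        · simp [huv]
      rw [if_pos hc, if_neg (by simp), if_pos ⟨hc, rfl⟩, hs, pow_succ]
      ring
  · rw [if_neg hc, if_neg fun h => hc h.1, if_neg fun h => hc h.1]
    simp

/-- The bracket of a disjoint union of circles is a power of the loop polynomial. -/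
theorem vertexBracket_circles (Γ : TrivalentRibbonGraph V H L) [Fintype V] (n : ℕ)
    (ν : V → Bool) :
    Γ.vertexBracket n (fun v => some (ν v)) =
      loopPolynomial n ^ Nat.card (Γ.StateCircle ν) := by
  classical
  unfold vertexBracket
  rw [Finset.sum_eq_single ν]
  · simp
  · intro ν' _ hne
    rw [if_neg]
    intro h
    exact hne (funext fun v => h v _ rfl)
  · simp

/-- The `n`-color vertex polynomial `⟪Γ⟫_n(q)`. -/
noncomputable def vertexPolynomial (Γ : TrivalentRibbonGraph V H L) [Fintype V] (n : ℕ) :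
    ℤ[T;T⁻¹] := Γ.vertexBracket n fun _ => none

end TrivalentRibbonGraph

/-! ## Euler characteristics over an arbitrary coefficient ring -/

/-- A subquotient of a free module of finite rank. -/
def IsFiniteFreeSubquotient (k M : Type*) [CommRing k] [AddCommGroup M] [Module k M] : Prop :=
  ∃ (r : ℕ) (N : Submodule k (Fin r → k)) (f : N →ₗ[k] M), Function.Surjective f

/-- A rank function on `k`-modules with values in an abelian group, additive on short exact sequences
of subquotients of free modules of finite rank. -/
structure AdditiveRank.{u, w} (k : Type u) [CommRing k] (A : Type w) [AddCommGroup A] where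
  rank : ∀ (M : Type u) [AddCommGroup M] [Module k M], A
  additive : ∀ (M₁ M₂ M₃ : Type u) [AddCommGroup M₁] [AddCommGroup M₂] [AddCommGroup M₃]
    [Module k M₁] [Module k M₂] [Module k M₃] (f : M₁ →ₗ[k] M₂) (g : M₂ →ₗ[k] M₃),
    Function.Injective f → Function.Exact f g → Function.Surjective g →
    IsFiniteFreeSubquotient k M₂ → rank M₂ = rank M₁ + rank M₃

/-!
The heart of the matter is that the edge maps of the hypercube of states of any perfect matching
graph commute; path independence and `δ² = 0` both follow from this. Instead of distinguishing how
two matching edges can meet the circles of a state, deform `k[x]/(xⁿ)` to `k[x]/(xⁿ - 1)`. Over `ℂ`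
the latter splits, and in the basis of colorings of the circles by `n`-th roots of unity every
deformed edge map is diagonal: its eigenvalue is `√n · u ^ m` if the two strands at the matching
edge have the same color `u`, and `0` otherwise. So the deformed maps commute, and the original
maps, being their leading parts with respect to the degree, commute as well. This identity in
`s = √n` passes from `±√n ∈ ℂ` to any ring with `s² = n`, because `ℤ[X]/(X² - n)` embeds into
`ℂ × ℂ`.

An equivalence of presentations carries monomials to monomials and vertex maps to vertex maps, so
only the numbering of the vertices matters; two numberings are compared by multiplying the summand
of `ν` by the sign counting the inversions among its `1`-smoothed vertices. The Euler
characteristic of homology agrees with that of the chain complex by telescoping.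
-/

/-! ## Circles of neighbouring states -/

theorem even_card_of_involution {α : Type*} (s : Finset α) (f : α → α)
    (mem : ∀ a ∈ s, f a ∈ s) (ne : ∀ a ∈ s, f a ≠ a) (invol : ∀ a ∈ s, f (f a) = a) :
    Even s.card := by
  rw [← ZMod.natCast_eq_zero_iff_even, Finset.card_eq_sum_ones, Nat.cast_sum]
  exact Finset.sum_involution (fun a _ => f a) (fun _ _ => by decide) (fun a ha _ => ne a ha)
    mem invol

namespace PerfectMatchingGraph

variable {M F : Type} (D : PerfectMatchingGraph M F)

/-- Two states differ at most at the matching edge `e`. -/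
def AgreeOff (e : M) (α β : M → Bool) : Prop := ∀ e', e' ≠ e → β e' = α e'

theorem AgreeOff.symm {e : M} {α β : M → Bool} (h : AgreeOff e α β) : AgreeOff e β α :=
  fun e' he => (h e' he).symm

theorem agreeOff_update [DecidableEq M] (e : M) (α : M → Bool) (b : Bool) :
    AgreeOff e α (Function.update α e b) :=
  fun _ he => Function.update_of_ne he _ _

/-- The half-edge on the side `b` of the end `false` of the matching edge `e`. -/
abbrev side (e : M) (b : Bool) : D.Point := Sum.inl (e, false, b)

/-- The circle of the state `α` through `D.side e b`.  The circles along `e` are always recorded at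
its end `false`, as the smoothing does not matter there. -/
def strand (α : M → Bool) (e : M) (b : Bool) : D.Circle α := D.circ α (D.side e b)

/-- The circle `c` runs through the matching edge `e`. -/
def Through (α : M → Bool) (e : M) (c : D.Circle α) : Prop :=
  c = D.strand α e false ∨ c = D.strand α e true

/-- The other endpoint of the arc of the state `α` which starts at `p` and runs along a matching
edge. -/
def alongBand (α : M → Bool) (p : M × Bool × Bool) : M × Bool × Bool :=
  (p.1, !p.2.1, xor p.2.2 (α p.1))

theorem alongBand_alongBand (α : M → Bool) (p : M × Bool × Bool) :
    alongBand α (alongBand α p) = p := by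
  simp [alongBand]

theorem alongBand_ne (α : M → Bool) (p : M × Bool × Bool) : alongBand α p ≠ p := fun h => by
  simpa [alongBand] using congrArg (fun p => p.2.1) h

theorem circ_out (α : M → Bool) (c : D.Circle α) : D.circ α c.out = c := Quot.out_eq c

theorem circ_join (α : M → Bool) (p : M × Bool × Bool) :
    D.circ α (Sum.inl (D.join p)) = D.circ α (Sum.inl p) :=
  (Quot.sound (Arc.join p)).symm

theorem circ_alongBand (α : M → Bool) (p : M × Bool × Bool) :
    D.circ α (Sum.inl (alongBand α p)) = D.circ α (Sum.inl p) := by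
  obtain ⟨e, _ | _, b⟩ := p
  · exact (Quot.sound (Arc.smoothing e b)).symm
  · have arc := Arc.smoothing (D := D) (α := α) e (xor b (α e))
    rw [Bool.xor_assoc, Bool.xor_self, Bool.xor_false] at arc
    exact Quot.sound arc

theorem circ_true (α : M → Bool) (e : M) (b : Bool) :
    D.circ α (Sum.inl (e, true, b)) = D.strand α e (xor b (α e)) :=
  (D.circ_alongBand α (e, true, b)).symm

theorem through_strand (α : M → Bool) (e : M) (b : Bool) : D.Through α e (D.strand α e b) := by
  cases b
  exacts [Or.inl rfl, Or.inr rfl]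

theorem through_circ (α : M → Bool) (e : M) (i b : Bool) :
    D.Through α e (D.circ α (Sum.inl (e, i, b))) := by
  cases i
  · exact D.through_strand α e b
  · exact D.circ_true α e b ▸ D.through_strand α e _

variable {D}

theorem circ_eq_or_through {e : M} {α β : M → Bool} (h : AgreeOff e α β) {p q : D.Point}
    (hpq : D.circ β p = D.circ β q) :
    D.circ α p = D.circ α q ∨ (D.Through α e (D.circ α p) ∧ D.Through α e (D.circ α q)) := by
  have hgen : Relation.EqvGen (D.Arc β) p q := Quot.eqvGen_exact hpq
  clear hpq
  induction hgen with
  | rel p q hpq =>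
    cases hpq with
    | join p => exact Or.inl (D.circ_join α p).symm
    | smoothing e' b =>
      by_cases he : e' = e
      · subst he
        exact Or.inr ⟨D.through_circ α e' _ _, D.through_circ α e' _ _⟩
      · rw [h e' he]
        exact Or.inl (D.circ_alongBand α (e', false, b)).symm
  | refl p => exact Or.inl rfl
  | symm p q _ ih => exact ih.imp Eq.symm And.symm
  | trans p q r _ _ ih₁ ih₂ =>
    rcases ih₁ with h₁ | h₁
    · exact h₁ ▸ ih₂
    · rcases ih₂ with h₂ | h₂
      · exact Or.inr (h₂ ▸ h₁)
      · exact Or.inr ⟨h₁.1, h₂.2⟩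

theorem through_of_through {e : M} {α β : M → Bool} (h : AgreeOff e α β) {p : D.Point}
    (hp : D.Through β e (D.circ β p)) : D.Through α e (D.circ α p) := by
  rcases hp with hp | hp <;> rcases circ_eq_or_through h hp with h' | h'
  exacts [h' ▸ D.through_strand .., h'.1, h' ▸ D.through_strand .., h'.1]

theorem circ_eq_of_not_through {e : M} {α β : M → Bool} (h : AgreeOff e α β) {p q : D.Point}
    (hp : ¬ D.Through α e (D.circ α p)) (hpq : D.circ β p = D.circ β q) :
    D.circ α p = D.circ α q :=
  (circ_eq_or_through h hpq).resolve_right fun h' => hp h'.1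

/-- The circles away from a matching edge do not change when its smoothing changes. -/
noncomputable def awayEquiv {e : M} {α β : M → Bool} (h : AgreeOff e α β) :
    {c // ¬ D.Through α e c} ≃ {c // ¬ D.Through β e c} :=
  have away : ∀ {α β : M → Bool}, AgreeOff e α β → ∀ c : {c // ¬ D.Through α e c},
      ¬ D.Through β e (D.circ β c.1.out) := fun h c hc =>
    c.2 (by simpa only [circ_out] using through_of_through h hc)
  have inv : ∀ {α β : M → Bool}, AgreeOff e α β → ∀ c : {c // ¬ D.Through α e c},
      D.circ α (D.circ β c.1.out).out = c.1 := fun {_ β} h c => by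
    rw [circ_eq_of_not_through h (q := c.1.out) (fun hc => ?_) (D.circ_out _ _), D.circ_out]
    exact away h c (by simpa only [circ_out] using through_of_through h.symm hc)
  { toFun := fun c => ⟨D.circ β c.1.out, away h c⟩
    invFun := fun c => ⟨D.circ α c.1.out, away h.symm c⟩
    left_inv := fun c => Subtype.ext (inv h c)
    right_inv := fun c => Subtype.ext (inv h.symm c) }

open Classical in
@[to_additive]
theorem prod_away {R : Type*} [CommMonoid R] {e : M} {α β : M → Bool}
    [Fintype (D.Circle α)] [Fintype (D.Circle β)] (h : AgreeOff e α β) {g : D.Circle α → R}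
    {g' : D.Circle β → R}
    (hg : ∀ p, ¬ D.Through α e (D.circ α p) → g (D.circ α p) = g' (D.circ β p)) :
    ∏ c : {c // ¬ D.Through α e c}, g c = ∏ c : {c // ¬ D.Through β e c}, g' c :=
  Fintype.prod_equiv (awayEquiv h) _ _ fun c => by
    have hc := hg c.1.out (by rw [circ_out]; exact c.2)
    rwa [circ_out] at hc

open Classical in
@[to_additive]
theorem prod_circle {R : Type*} [CommMonoid R] (α : M → Bool) (e : M) [Fintype (D.Circle α)]
    (g : D.Circle α → R) :
    ∏ c, g c = (if D.strand α e false ≠ D.strand α e true then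
        g (D.strand α e false) * g (D.strand α e true) else g (D.strand α e false)) *
      ∏ c : {c // ¬ D.Through α e c}, g c := by
  rw [← Fintype.prod_subtype_mul_prod_subtype (D.Through α e)]
  congr 1
  rw [← Finset.prod_subtype {D.strand α e false, D.strand α e true} (fun c => by simp [Through])]
  split_ifs with hne
  · exact Finset.prod_pair hne
  · simp [← not_ne_iff.mp hne]

theorem even_card_of_alongBand_mem {e : M} {α : M → Bool} {s : Finset (M × Bool × Bool)}
    [DecidableEq M] (hs : ∀ p, p.1 ≠ e → p ∈ s → alongBand α p ∈ s) :
    Even (s.filter (¬ ·.1 = e)).card :=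
  even_card_of_involution _ (alongBand α)
    (fun p hp => by
      rw [Finset.mem_filter] at hp ⊢
      exact ⟨hs p hp.2 hp.1, hp.2⟩)
    (fun p _ => alongBand_ne α p) (fun p _ => alongBand_alongBand α p)

/- The half-edges which lie on the circle of `(e, false, false)` both for `α` and for `β` come in
pairs along the non-matching edges; away from `e` they also come in pairs along the matching edges.
Were there two circles through `e` for both states, this would leave out `(e, false, false)`
alone. -/
theorem strand_eq_of_strand_ne [Finite M] {e : M} {α β : M → Bool} (h : AgreeOff e α β)
    (hα : α e = false) (hβ : β e = true) (hne : D.strand α e false ≠ D.strand α e true) :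
    D.strand β e false = D.strand β e true := by
  classical
  have := Fintype.ofFinite M
  by_contra hne'
  let s : Finset (M × Bool × Bool) := {p | D.circ α (Sum.inl p) = D.strand α e false ∧
    D.circ β (Sum.inl p) = D.strand β e false}
  have even_s : Even s.card :=
    even_card_of_involution s D.join (by simp [s, circ_join]) (fun p _ => D.join_ne p)
      (fun p _ => D.join_join p)
  have even_off : Even (s.filter (¬ ·.1 = e)).card := by
    refine even_card_of_alongBand_mem (α := α) fun p he hp => ?_
    have along : alongBand α p = alongBand β p := by simp [alongBand, h p.1 he]
    simp only [s, Finset.mem_filter_univ] at hp ⊢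
    exact ⟨(D.circ_alongBand α p).trans hp.1, along ▸ (D.circ_alongBand β p).trans hp.2⟩
  have at_e : s.filter (·.1 = e) = {(e, false, false)} := by
    have only : ∀ i b, (e, i, b) ∈ s → i = false ∧ b = false := by
      intro i b hp
      simp only [s, Finset.mem_filter_univ] at hp
      cases i
      · cases b
        exacts [⟨rfl, rfl⟩, absurd hp.1.symm hne]
      · simp only [circ_true, hα, hβ, Bool.xor_false, Bool.xor_true] at hp
        cases b
        exacts [absurd hp.2.symm hne', absurd hp.1.symm hne]
    ext ⟨e', i, b⟩
    simp only [Finset.mem_filter, Finset.mem_singleton, Prod.mk.injEq]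
    refine ⟨fun ⟨hp, he⟩ => ⟨he, only i b (he ▸ hp)⟩, ?_⟩
    rintro ⟨rfl, rfl, rfl⟩
    exact ⟨(Finset.mem_filter_univ _).2 ⟨rfl, rfl⟩, rfl⟩
  rw [← Finset.card_filter_add_card_filter_not (s := s) (·.1 = e), at_e,
    Finset.card_singleton] at even_s
  exact absurd even_s (by rw [Nat.even_add']; simp [even_off])

end PerfectMatchingGraph

/-! ## Edge maps of arbitrary structure constants and their diagonalization -/

section SumAgreeOff

variable {ι κ R : Type*} [Fintype κ] [AddCommMonoid R] {s : Finset (ι → κ)} {b₀ : ι → κ}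

theorem sum_of_mem_iff_eq_off {d : ι} (hs : ∀ b, b ∈ s ↔ ∀ c, c ≠ d → b c = b₀ c) (G : κ → R) :
    ∑ b ∈ s, G (b d) = ∑ i, G i := by
  classical
  refine (Finset.sum_bij' (fun i _ => Function.update b₀ d i) (fun b _ => b d)
    ?_ ?_ ?_ ?_ ?_).symm
  · simp +contextual [hs]
  · simp
  · simp
  · intro b hb
    exact (Function.eq_update_iff.2 ⟨rfl, (hs b).1 hb⟩).symm
  · simp

theorem sum_of_mem_iff_eq_off_pair {d d' : ι} (hd : d ≠ d')
    (hs : ∀ b, b ∈ s ↔ ∀ c, c ≠ d → c ≠ d' → b c = b₀ c) (G : κ → κ → R) :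
    ∑ b ∈ s, G (b d) (b d') = ∑ i, ∑ j, G i j := by
  classical
  rw [← Fintype.sum_prod_type']
  refine (Finset.sum_bij' (fun p _ => Function.update (Function.update b₀ d p.1) d' p.2)
    (fun b _ => (b d, b d')) ?_ ?_ ?_ ?_ ?_).symm
  · simp +contextual [hs]
  · simp
  · simp [hd]
  · intro b hb
    refine (Function.eq_update_iff.2 ⟨rfl, fun c hc' => ?_⟩).symm
    by_cases hc : c = d
    · simp [hc]
    · simp [hc, (hs b).1 hb c hc hc']
  · simp [hd]

end SumAgreeOff

/-- Structure constants, in a basis indexed by `Fin n`, of a multiplication (`mul i j l` is the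
coefficient of `l` in the product of `i` and `j`), a comultiplication (`comul l i j` is the
coefficient of `i ⊗ j` in the coproduct of `l`) and an endomorphism (`eta i j` is the coefficient
of `j` in the image of `i`).  They determine edge maps on any hypercube of states. -/
structure EdgeTable (k : Type*) (n : ℕ) where
  mul : Fin n → Fin n → Fin n → k
  comul : Fin n → Fin n → Fin n → k
  eta : Fin n → Fin n → k

open Classical in
/-- A simultaneous diagonalization of a table: for each color `u`, the row vector `weight u` is a
common eigenvector of the three maps in the sense of the first three identities, all of them with
the eigenvalue `eigenvalue u`, and the matrix `dual` inverts the matrix `weight`. -/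
structure EdgeTable.Diagonalization {K : Type*} [CommRing K] {n : ℕ} (t : EdgeTable K n)
    (C : Type*) [Fintype C] where
  weight : C → Fin n → K
  eigenvalue : C → K
  dual : C → Fin n → K
  sum_mul : ∀ u i j, ∑ l, t.mul i j l * weight u l =
    eigenvalue u * (weight u i * weight u j)
  sum_comul : ∀ u v l, ∑ i, ∑ j, t.comul l i j * (weight u i * weight v j) =
    if u = v then eigenvalue u * weight u l else 0
  sum_eta : ∀ u i, ∑ j, t.eta i j * weight u j = eigenvalue u * weight u i
  sum_weight_mul_dual : ∀ b a, ∑ u, weight u b * dual u a = if a = b then 1 else 0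

namespace PerfectMatchingGraph

open scoped Matrix

variable {M F : Type} {D : PerfectMatchingGraph M F} {n : ℕ}

noncomputable instance [Finite M] [Finite F] (α : M → Bool) : Fintype (D.Circle α) :=
  Fintype.ofFinite _

/-- The monomial `y` can occur in the image of the monomial `x` under the maps which change the
smoothing of `e` from `0` to `1`, as far as its state and its exponents on the circles away from
`e` are concerned. -/
structure IsStep (e : M) (x y : D.Monomial n) : Prop where
  source : x.1 e = false
  target : y.1 e = true
  agreeOff : AgreeOff e x.1 y.1
  away : ∀ p, ¬ D.Through x.1 e (D.circ x.1 p) → y.2 (D.circ y.1 p) = x.2 (D.circ x.1 p)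

open Classical in
/-- The matrix entry from `x` to `y` of the edge maps of the direction `e` which are built from the
structure constants `t`. -/
noncomputable def tableCoeff {k : Type*} [Zero k] (t : EdgeTable k n) (e : M)
    (x y : D.Monomial n) : k :=
  if IsStep e x y then
    if D.strand x.1 e false ≠ D.strand x.1 e true then
      t.mul (x.2 (D.strand x.1 e false)) (x.2 (D.strand x.1 e true)) (y.2 (D.strand y.1 e false))
    else if D.strand y.1 e false ≠ D.strand y.1 e true then
      t.comul (x.2 (D.strand x.1 e false)) (y.2 (D.strand y.1 e false))
        (y.2 (D.strand y.1 e true))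
    else t.eta (x.2 (D.strand x.1 e false)) (y.2 (D.strand y.1 e false))
  else 0

variable (D) in
/-- The matrix of the entries `tableCoeff`, with the source of the edge maps as row index, that is,
acting from the right. -/
noncomputable def tableMatrix {k : Type*} [Zero k] (t : EdgeTable k n) (e : M) :
    Matrix (D.Monomial n) (D.Monomial n) k :=
  Matrix.of fun x y => tableCoeff t e x y

theorem tableCoeff_of_not_isStep {k : Type*} [Zero k] (t : EdgeTable k n) {e : M}
    {x y : D.Monomial n} (h : ¬ IsStep e x y) : tableCoeff t e x y = 0 :=
  if_neg h

theorem factorsThrough_of_agreeOff {C : Type*} {e : M} {α β : M → Bool} (h : AgreeOff e α β)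
    {f : D.Point → C} (he : f (D.side e false) = f (D.side e true))
    (hf : f.FactorsThrough (D.circ α)) : f.FactorsThrough (D.circ β) := by
  have through : ∀ p, D.Through α e (D.circ α p) → f p = f (D.side e false) := by
    rintro p (hp | hp)
    exacts [hf hp, (hf hp).trans he.symm]
  intro p q hpq
  rcases circ_eq_or_through h hpq with h' | h'
  exacts [hf h', (through p h'.1).trans (through q h'.2).symm]

open Classical in
theorem sum_isStep {R : Type*} [AddCommMonoid R] [Finite M] [Finite F] {e : M} {x : D.Monomial n}
    {β : M → Bool} (hx : x.1 e = false) (hβ : β e = true) (h : AgreeOff e x.1 β)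
    (G : Fin n → Fin n → R) :
    ∑ b : D.Circle β → Fin n with IsStep e x ⟨β, b⟩,
      G (b (D.strand β e false)) (b (D.strand β e true)) =
      if D.strand β e false ≠ D.strand β e true then ∑ i, ∑ j, G i j else ∑ i, G i i := by
  have isStep_iff : ∀ b : D.Circle β → Fin n, IsStep e x ⟨β, b⟩ ↔ ∀ c, c ≠ D.strand β e false →
      c ≠ D.strand β e true → b c = x.2 (D.circ x.1 c.out) := by
    refine fun b => ⟨fun hb c hc hc' => ?_, fun hb => ⟨hx, hβ, h, fun p hp => ?_⟩⟩
    · have hc_away : ¬ D.Through β e (D.circ β c.out) := by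
        rw [circ_out]
        exact not_or.2 ⟨hc, hc'⟩
      rw [← hb.away c.out fun hp => hc_away (through_of_through h.symm hp), circ_out]
    · obtain ⟨hp₀, hp₁⟩ := not_or.1 fun hp' => hp (through_of_through h hp')
      exact (hb _ hp₀ hp₁).trans
        (congrArg x.2 (circ_eq_of_not_through h hp (D.circ_out β (D.circ β p)).symm).symm)
  have mem_iff : ∀ b, b ∈ ({b | IsStep e x ⟨β, b⟩} : Finset (D.Circle β → Fin n)) ↔ _ := fun b =>
    (Finset.mem_filter_univ b).trans (isStep_iff b)
  split_ifs with hne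
  · exact sum_of_mem_iff_eq_off_pair hne mem_iff G
  · rw [← not_ne_iff.1 hne] at mem_iff ⊢
    exact sum_of_mem_iff_eq_off (by simpa using mem_iff) fun i => G i i

section ColorVector

variable {K : Type*} [CommRing K] {t : EdgeTable K n} {C : Type*} [Fintype C]
  (δ : t.Diagonalization C) [Finite M] [Finite F] {e : M} {x : D.Monomial n} {β : M → Bool}
  {f : D.Point → C}

open Classical in
/-- The vector of the coloring `f` of the circles of the state `β`, which is the tensor product of
the vectors `weight` of the colors.  Colorings are maps on points, so that they can be compared
between states; the vector is zero if `f` is not constant on the circles of `β`. -/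
noncomputable def colorVector (f : D.Point → C) (β : M → Bool) (y : D.Monomial n) : K :=
  if y.1 = β ∧ f.FactorsThrough (D.circ β) then ∏ c, δ.weight (f c.out) (y.2 c) else 0

open Classical in
theorem colorVector_mk (hf : f.FactorsThrough (D.circ β)) (e : M) (b : D.Circle β → Fin n) :
    colorVector δ f β ⟨β, b⟩ =
      (if D.strand β e false ≠ D.strand β e true then
        δ.weight (f (D.side e false)) (b (D.strand β e false)) *
          δ.weight (f (D.side e true)) (b (D.strand β e true))
      else δ.weight (f (D.side e false)) (b (D.strand β e false))) *
      ∏ c : {c // ¬ D.Through β e c}, δ.weight (f c.1.out) (b c) := by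
  have out : ∀ b', f (D.strand β e b').out = f (Sum.inl (e, false, b')) := fun b' =>
    hf (D.circ_out β _)
  rw [colorVector, if_pos ⟨rfl, hf⟩, ← out, ← out,
    ← prod_circle β e fun c => δ.weight (f c.out) (b c)]

open Classical in
theorem prod_away_weight_of_isStep {b : D.Circle β → Fin n} (hf : f.FactorsThrough (D.circ β))
    (hb : IsStep e x ⟨β, b⟩) :
    ∏ c : {c // ¬ D.Through β e c}, δ.weight (f c.1.out) (b c) =
      ∏ c : {c // ¬ D.Through x.1 e c}, δ.weight (f c.1.out) (x.2 c) := by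
  refine (prod_away (g := fun c => δ.weight (f c.out) (x.2 c))
    (g' := fun c => δ.weight (f c.out) (b c)) hb.agreeOff fun p hp => ?_).symm
  have away := (circ_eq_of_not_through hb.agreeOff.symm
    (fun h => hp (through_of_through hb.agreeOff h)) (D.circ_out x.1 (D.circ x.1 p)).symm).symm
  simp only [hf (D.circ_out β (D.circ β p)), ← hb.away p hp, hf away]

open Classical in
theorem sum_fiber_tableCoeff_mul_colorVector (hx : x.1 e = false) (hβ : β e = true)
    (h : AgreeOff e x.1 β) (hf : f.FactorsThrough (D.circ β)) (a : Fin n → Fin n → K)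
    (ha : ∀ b : D.Circle β → Fin n, IsStep e x ⟨β, b⟩ →
      tableCoeff t e x ⟨β, b⟩ = a (b (D.strand β e false)) (b (D.strand β e true))) :
    ∑ b : D.Circle β → Fin n, tableCoeff t e x ⟨β, b⟩ * colorVector δ f β ⟨β, b⟩ =
      (if D.strand β e false ≠ D.strand β e true then ∑ i, ∑ j, a i j *
        (δ.weight (f (D.side e false)) i * δ.weight (f (D.side e true)) j)
      else ∑ i, a i i * δ.weight (f (D.side e false)) i) *
      ∏ c : {c // ¬ D.Through x.1 e c}, δ.weight (f c.1.out) (x.2 c) := by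
  have term : ∀ b : D.Circle β → Fin n, tableCoeff t e x ⟨β, b⟩ * colorVector δ f β ⟨β, b⟩ =
      if IsStep e x ⟨β, b⟩ then a (b (D.strand β e false)) (b (D.strand β e true)) *
        (if D.strand β e false ≠ D.strand β e true then
          δ.weight (f (D.side e false)) (b (D.strand β e false)) *
            δ.weight (f (D.side e true)) (b (D.strand β e true))
        else δ.weight (f (D.side e false)) (b (D.strand β e false))) *
        ∏ c : {c // ¬ D.Through x.1 e c}, δ.weight (f c.1.out) (x.2 c) else 0 := by
    intro b
    split_ifs with hb hd
    · rw [ha b hb, colorVector_mk δ hf e, if_pos hd, prod_away_weight_of_isStep δ hf hb,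
        mul_assoc (a _ _)]
    · rw [ha b hb, colorVector_mk δ hf e, if_neg hd, prod_away_weight_of_isStep δ hf hb, mul_assoc]
    · rw [tableCoeff_of_not_isStep t hb, zero_mul]
  simp only [term, ← Finset.sum_filter, ← Finset.sum_mul]
  congr 1
  split_ifs with hd
  · refine (sum_isStep hx hβ h fun i j => a i j * (δ.weight (f (D.side e false)) i *
      δ.weight (f (D.side e true)) j)).trans (if_pos hd)
  · rw [← not_ne_iff.1 hd]
    exact (sum_isStep hx hβ h fun i _ => a i i * δ.weight (f (D.side e false)) i).trans
      (if_neg hd)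

open Classical in
theorem sum_fiber_eq_eigenvalue_mul_colorVector (hx : x.1 e = false) (hβ : β e = true)
    (h : AgreeOff e x.1 β) (hf : f.FactorsThrough (D.circ β)) :
    ∑ b : D.Circle β → Fin n, tableCoeff t e x ⟨β, b⟩ * colorVector δ f β ⟨β, b⟩ =
      if f (D.side e false) = f (D.side e true) then
        δ.eigenvalue (f (D.side e false)) * colorVector δ f x.1 x else 0 := by
  have same_color : D.strand β e false = D.strand β e true →
      f (D.side e false) = f (D.side e true) := fun hd => hf hd
  have image : f (D.side e false) = f (D.side e true) →
      colorVector δ f x.1 x = _ := fun huv =>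
    colorVector_mk δ (factorsThrough_of_agreeOff h.symm huv hf) e x.2
  by_cases hc : D.strand x.1 e false = D.strand x.1 e true
  · by_cases hd : D.strand β e false = D.strand β e true
    · rw [sum_fiber_tableCoeff_mul_colorVector δ hx hβ h hf
          (fun i _ => t.eta (x.2 (D.strand x.1 e false)) i) fun b hb => by simp [tableCoeff, *],
        if_neg (not_not.2 hd), δ.sum_eta, if_pos (same_color hd), image (same_color hd),
        if_neg (not_not.2 hc), mul_assoc]
    · rw [sum_fiber_tableCoeff_mul_colorVector δ hx hβ h hf
          (t.comul (x.2 (D.strand x.1 e false))) fun b hb => by simp [tableCoeff, *],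
        if_pos hd, δ.sum_comul]
      split_ifs with huv
      · rw [image huv, if_neg (not_not.2 hc), mul_assoc]
      · exact zero_mul _
  · have hd : D.strand β e false = D.strand β e true := strand_eq_of_strand_ne h hx hβ hc
    rw [sum_fiber_tableCoeff_mul_colorVector δ hx hβ h hf (fun i _ => t.mul
        (x.2 (D.strand x.1 e false)) (x.2 (D.strand x.1 e true)) i) fun b hb => by
          simp [tableCoeff, *],
      if_neg (not_not.2 hd), δ.sum_mul, if_pos (same_color hd), image (same_color hd),
      if_pos hc, ← same_color hd, mul_assoc]

open Classical in
theorem sum_eq_sum_fiber {R : Type*} [AddCommMonoid R] {g : D.Monomial n → R}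
    (hg : ∀ y, y.1 ≠ β → g y = 0) : ∑ y, g y = ∑ b : D.Circle β → Fin n, g ⟨β, b⟩ := by
  refine (Fintype.sum_of_injective (fun b => (⟨β, b⟩ : D.Monomial n))
    (fun _ _ h => by simpa using h) _ _ (fun y hy => hg y ?_) fun _ => rfl).symm
  rintro rfl
  exact hy ⟨y.2, rfl⟩

theorem colorVector_eq_zero {y : D.Monomial n} (h : ¬ (y.1 = β ∧ f.FactorsThrough (D.circ β))) :
    colorVector δ f β y = 0 :=
  if_neg h

open Classical in
theorem sum_tableCoeff_mul_colorVector (e : M) (f : D.Point → C) (β : M → Bool)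
    (x : D.Monomial n) :
    ∑ y, tableCoeff t e x y * colorVector δ f β y =
      if β e = true ∧ f (D.side e false) = f (D.side e true) then
        δ.eigenvalue (f (D.side e false)) * colorVector δ f (Function.update β e false) x
      else 0 := by
  have off_state : ∀ y, y.1 ≠ β → tableCoeff t e x y * colorVector δ f β y = 0 := fun y hy => by
    rw [colorVector_eq_zero δ fun h => hy h.1, mul_zero]
  rw [sum_eq_sum_fiber off_state]
  by_cases hstep : β e = true ∧ x.1 = Function.update β e false
  · obtain ⟨hβ, hx⟩ := hstep
    have h : AgreeOff e x.1 β := hx ▸ (agreeOff_update e β false).symm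
    by_cases hf : f.FactorsThrough (D.circ β)
    · rw [sum_fiber_eq_eigenvalue_mul_colorVector δ (by simp [hx]) hβ h hf, hx]
      simp [hβ]
    · rw [Finset.sum_eq_zero fun b _ => by rw [colorVector_eq_zero δ fun h => hf h.2, mul_zero]]
      split_ifs with hc
      · rw [colorVector_eq_zero δ fun hx' => hf (factorsThrough_of_agreeOff h hc.2 (hx ▸ hx'.2)),
          mul_zero]
      · rfl
  · rw [Finset.sum_eq_zero fun b _ => ?_]
    · split_ifs with hc
      · rw [colorVector_eq_zero δ fun hx => hstep ⟨hc.1, hx.1⟩, mul_zero]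
      · rfl
    · rw [tableCoeff_of_not_isStep t fun hb => hstep ⟨hb.target, ?_⟩, zero_mul]
      exact Function.eq_update_iff.2 ⟨hb.source, fun e' he => (hb.agreeOff e' he).symm⟩

open Classical in
theorem tableMatrix_mulVec_colorVector (e : M) (f : D.Point → C) (β : M → Bool) :
    D.tableMatrix t e *ᵥ colorVector δ f β =
      if β e = true ∧ f (D.side e false) = f (D.side e true) then
        δ.eigenvalue (f (D.side e false)) • colorVector δ f (Function.update β e false)
      else 0 := by
  ext x
  refine (sum_tableCoeff_mul_colorVector δ e f β x).trans ?_
  split_ifs <;> rfl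

open Classical in
theorem single_eq_sum_colorVector (x : D.Monomial n) :
    Pi.single x (1 : K) = ∑ g : D.Circle x.1 → C,
      (∏ c, δ.dual (g c) (x.2 c)) • colorVector δ (g ∘ D.circ x.1) x.1 := by
  ext y
  rw [Finset.sum_apply]
  obtain ⟨β, a⟩ := x
  by_cases hy : y.1 = β
  · obtain ⟨β', b⟩ := y
    obtain rfl : β' = β := hy
    have expand : ∀ g : D.Circle β' → C, ((∏ c, δ.dual (g c) (a c)) •
        colorVector δ (g ∘ D.circ β') β' : D.Monomial n → K) ⟨β', b⟩ =
          ∏ c, (δ.weight (g c) (b c) * δ.dual (g c) (a c)) := fun g => by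
      have factors : (g ∘ D.circ β').FactorsThrough (D.circ β') := fun p q => congrArg g
      rw [Pi.smul_apply, smul_eq_mul, colorVector, if_pos ⟨rfl, factors⟩, mul_comm,
        ← Finset.prod_mul_distrib]
      simp [circ_out]
    simp only [expand]
    rw [← Fintype.prod_sum fun c u => δ.weight u (b c) * δ.dual u (a c)]
    simp [δ.sum_weight_mul_dual, Finset.prod_ite_zero, Pi.single_apply, funext_iff, eq_comm]
  · rw [Pi.single_eq_of_ne fun h => hy (congrArg Sigma.fst h)]
    exact (Finset.sum_eq_zero fun g _ => by
      rw [Pi.smul_apply, colorVector_eq_zero δ fun h => hy h.1, smul_zero]).symm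

theorem ext_of_mulVec_colorVector {A B : Matrix (D.Monomial n) (D.Monomial n) K}
    (h : ∀ f β, A *ᵥ colorVector δ f β = B *ᵥ colorVector δ f β) : A = B := by
  classical
  refine Matrix.ext_of_mulVec_single fun x => ?_
  simp only [single_eq_sum_colorVector δ, Matrix.mulVec_sum, Matrix.mulVec_smul, h]

open Classical in
theorem tableMatrix_mulVec_mulVec_colorVector {e e' : M} (he : e ≠ e') (f : D.Point → C)
    (β : M → Bool) :
    D.tableMatrix t e *ᵥ (D.tableMatrix t e' *ᵥ colorVector δ f β) =
      if (β e' = true ∧ f (D.side e' false) = f (D.side e' true)) ∧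
          (β e = true ∧ f (D.side e false) = f (D.side e true)) then
        (δ.eigenvalue (f (D.side e' false)) * δ.eigenvalue (f (D.side e false))) •
          colorVector δ f (Function.update (Function.update β e' false) e false)
      else 0 := by
  rw [tableMatrix_mulVec_colorVector]
  by_cases h' : β e' = true ∧ f (D.side e' false) = f (D.side e' true)
  · rw [if_pos h', Matrix.mulVec_smul, tableMatrix_mulVec_colorVector, Function.update_of_ne he]
    simp only [h', and_self, true_and, smul_ite, smul_smul, smul_zero]
  · rw [if_neg h', if_neg fun h => h' h.1, Matrix.mulVec_zero]

theorem commute_tableMatrix (δ : t.Diagonalization C) (e e' : M) :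
    Commute (D.tableMatrix t e) (D.tableMatrix t e') := by
  classical
  obtain rfl | he := eq_or_ne e e'
  · exact Commute.refl _
  refine ext_of_mulVec_colorVector δ fun f β => ?_
  rw [← Matrix.mulVec_mulVec, ← Matrix.mulVec_mulVec,
    tableMatrix_mulVec_mulVec_colorVector δ he, tableMatrix_mulVec_mulVec_colorVector δ he.symm]
  exact if_congr and_comm (by rw [mul_comm, Function.update_comm he]) rfl

end ColorVector

end PerfectMatchingGraph

/-! ## The cyclic deformation -/

section RootsOfUnity

variable {K : Type*} [Field K] {n : ℕ} {u v : K}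

theorem sum_ite_modEq_pow (hn : 0 < n) (hu : u ^ n = 1) (t : ℕ) :
    ∑ j : Fin n, (if (j : ℕ) ≡ t [MOD n] then u ^ (j : ℕ) else 0) = u ^ t := by
  rw [Finset.sum_eq_single (⟨t % n, Nat.mod_lt _ hn⟩ : Fin n)]
  · rw [if_pos (Nat.mod_modEq t n)]
    exact pow_eq_pow_of_modEq (Nat.mod_modEq t n) hu
  · intro j _ hj
    exact if_neg fun h => hj (Fin.ext ((Nat.mod_eq_of_lt j.2).symm.trans h))
  · simp

theorem sum_ite_add_modEq_pow (hn : 0 < n) (hv : v ^ n = 1) (i : Fin n) (t : ℕ) :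
    ∑ j : Fin n, (if (i : ℕ) + j ≡ t [MOD n] then v ^ (j : ℕ) else 0) =
      v ^ t * (v ^ (i : ℕ))⁻¹ := by
  have add_sub : (i : ℕ) + (t + (n - i)) ≡ t [MOD n] := by
    rw [show (i : ℕ) + (t + (n - i)) = t + n by omega]
    exact Nat.add_modEq_right
  have modEq_iff (j : Fin n) : (i : ℕ) + j ≡ t [MOD n] ↔ (j : ℕ) ≡ t + (n - i) [MOD n] :=
    ⟨fun h => Nat.ModEq.add_left_cancel' i (h.trans add_sub.symm),
      fun h => (h.add_left i).trans add_sub⟩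
  simp only [modEq_iff]
  rw [sum_ite_modEq_pow hn hv, pow_add]
  congr 1
  refine eq_inv_of_mul_eq_one_left ?_
  rw [← pow_add, Nat.sub_add_cancel i.2.le, hv]

open Classical in
theorem sum_pow_mul_inv_pow (hn : 0 < n) (hu : u ^ n = 1) (hv : v ^ n = 1) :
    ∑ i : Fin n, u ^ (i : ℕ) * (v ^ (i : ℕ))⁻¹ = if u = v then (n : K) else 0 := by
  have hv₀ : v ≠ 0 := (IsUnit.of_pow_eq_one hv hn.ne').ne_zero
  simp only [← div_eq_mul_inv, ← div_pow]
  rw [Fin.sum_univ_eq_sum_range fun i => (u / v) ^ i]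
  split_ifs with h
  · simp [h, hv₀]
  · rw [geom_sum_eq fun h' => h ((div_eq_one_iff_eq hv₀).1 h'), div_pow, hu, hv]
    simp

open Classical in
theorem sum_sum_ite_add_modEq_pow (hn : 0 < n) (hu : u ^ n = 1) (hv : v ^ n = 1) (t : ℕ) :
    ∑ i : Fin n, ∑ j : Fin n,
      (if (i : ℕ) + j ≡ t [MOD n] then u ^ (i : ℕ) * v ^ (j : ℕ) else 0) =
      if u = v then n * v ^ t else 0 := by
  simp only [← mul_ite_zero, ← Finset.mul_sum, sum_ite_add_modEq_pow hn hv, mul_left_comm _ (v ^ t)]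
  rw [sum_pow_mul_inv_pow hn hu hv]
  split_ifs <;> ring

end RootsOfUnity

/-- The structure constants obtained from those of the maps `m`, `Δ` and `η` by replacing the
algebra `k[x]/(xⁿ)` with the group algebra `k[x]/(xⁿ - 1)`. -/
def cyclicTable {k : Type*} [CommRing k] (n : ℕ) (s : k) : EdgeTable k n where
  mul i j l := if (l : ℕ) ≡ i + j [MOD n] then 1 else 0
  comul l i j := if (i : ℕ) + j ≡ l + 2 * (n / 2) [MOD n] then 1 else 0
  eta i j := if (j : ℕ) ≡ i + n / 2 [MOD n] then s else 0

section Characters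

variable {K : Type*} [Field K] {n : ℕ} {u v s : K}

/-- The row vector of the character of `ℤ/n` with value `u` at `1`, scaled so that the maps of the
cyclic table have the same eigenvalue at it. -/
def characterVector (n : ℕ) (s u : K) (a : Fin n) : K := (s * u ^ (n / 2))⁻¹ * u ^ (a : ℕ)

theorem sum_cyclicTable_mul_mul_characterVector (hn : 0 < n) (hs : s ≠ 0) (hu : u ^ n = 1)
    (i j : Fin n) :
    ∑ l, (cyclicTable n s).mul i j l * characterVector n s u l =
      s * u ^ (n / 2) * (characterVector n s u i * characterVector n s u j) := by
  have hu₀ : u ≠ 0 := (IsUnit.of_pow_eq_one hu hn.ne').ne_zero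
  simp only [cyclicTable, characterVector, ite_mul, one_mul, zero_mul, ← mul_ite_zero,
    ← Finset.mul_sum, sum_ite_modEq_pow hn hu, pow_add]
  field_simp

theorem sum_cyclicTable_eta_mul_characterVector (hn : 0 < n) (hs : s ≠ 0) (hu : u ^ n = 1)
    (i : Fin n) :
    ∑ j, (cyclicTable n s).eta i j * characterVector n s u j =
      s * u ^ (n / 2) * characterVector n s u i := by
  have hu₀ : u ≠ 0 := (IsUnit.of_pow_eq_one hu hn.ne').ne_zero
  simp only [cyclicTable, characterVector, ite_mul, zero_mul, ← mul_ite_zero,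
    ← Finset.mul_sum, sum_ite_modEq_pow hn hu, pow_add]
  field_simp

open Classical in
theorem sum_cyclicTable_comul_mul_characterVector (hn : 0 < n) (hs : s ≠ 0) (hsn : s ^ 2 = n)
    (hu : u ^ n = 1) (hv : v ^ n = 1) (l : Fin n) :
    ∑ i, ∑ j, (cyclicTable n s).comul l i j * (characterVector n s u i * characterVector n s v j) =
      if u = v then s * u ^ (n / 2) * characterVector n s u l else 0 := by
  have hu₀ : u ≠ 0 := (IsUnit.of_pow_eq_one hu hn.ne').ne_zero
  calc _ = (s * u ^ (n / 2))⁻¹ * (s * v ^ (n / 2))⁻¹ * ∑ i : Fin n, ∑ j : Fin n,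
        (if (i : ℕ) + j ≡ l + 2 * (n / 2) [MOD n] then u ^ (i : ℕ) * v ^ (j : ℕ) else 0) := by
        simp only [cyclicTable, characterVector, Finset.mul_sum, ite_mul, mul_ite, one_mul,
          zero_mul, mul_zero, mul_mul_mul_comm]
    _ = if u = v then s * u ^ (n / 2) * characterVector n s u l else 0 := by
        rw [sum_sum_ite_add_modEq_pow hn hu hv, ← hsn, pow_add, pow_mul', characterVector]
        split_ifs with huv
        · rw [← huv]
          field_simp
        · exact mul_zero _

end Characters

open Classical in
/-- The diagonalization of the cyclic table by the characters of `ℤ/n`. -/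
noncomputable def cyclicTableDiagonalization {K : Type*} [Field K] {n : ℕ} {ζ s : K}
    (hζ : IsPrimitiveRoot ζ n) (hs : s ^ 2 = n) (hn : (n : K) ≠ 0) :
    (cyclicTable n s).Diagonalization (Fin n) :=
  have hn₀ : 0 < n := Nat.pos_of_ne_zero fun h => hn (by simp [h])
  have hs₀ : s ≠ 0 := fun h => hn (by simp [← hs, h])
  have hroot (a : ℕ) : (ζ ^ a) ^ n = 1 := by rw [pow_right_comm, hζ.pow_eq_one, one_pow]
  have hinj (a b : Fin n) : ζ ^ (a : ℕ) = ζ ^ (b : ℕ) ↔ a = b :=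
    ⟨fun h => Fin.ext (hζ.pow_inj a.2 b.2 h), fun h => h ▸ rfl⟩
  { weight := fun u => characterVector n s (ζ ^ (u : ℕ))
    eigenvalue := fun u => s * (ζ ^ (u : ℕ)) ^ (n / 2)
    dual := fun u a => (n : K)⁻¹ * (s * (ζ ^ (u : ℕ)) ^ (n / 2)) * ((ζ ^ (u : ℕ)) ^ (a : ℕ))⁻¹
    sum_mul := fun u => sum_cyclicTable_mul_mul_characterVector hn₀ hs₀ (hroot u)
    sum_comul := fun u v l => by
      convert sum_cyclicTable_comul_mul_characterVector hn₀ hs₀ hs (hroot u) (hroot v) l using 2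
      exact (hinj u v).symm
    sum_eta := fun u => sum_cyclicTable_eta_mul_characterVector hn₀ hs₀ (hroot u)
    sum_weight_mul_dual := fun b a => by
      have hζ₀ : ζ ≠ 0 := hζ.ne_zero hn₀.ne'
      calc _ = ∑ u : Fin n, (n : K)⁻¹ *
            ((ζ ^ (b : ℕ)) ^ (u : ℕ) * ((ζ ^ (a : ℕ)) ^ (u : ℕ))⁻¹) :=
            Finset.sum_congr rfl fun u _ => by
              rw [characterVector, pow_right_comm ζ b, pow_right_comm ζ a]
              field_simp
        _ = if a = b then 1 else 0 := by
            rw [← Finset.mul_sum, sum_pow_mul_inv_pow hn₀ (hroot b) (hroot a), mul_ite_zero,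
              inv_mul_cancel₀ hn]
            exact if_congr ((hinj b a).trans eq_comm) rfl rfl }

/-! ## Commutativity of the edge maps -/

/-- The structure constants of the maps `m`, `Δ` and `η`. -/
def truncatedTable {k : Type*} [CommRing k] (n : ℕ) (s : k) : EdgeTable k n where
  mul := mulCoeff k
  comul := comulCoeff k
  eta := etaCoeff s

namespace PerfectMatchingGraph

section Degree

variable {M F : Type} {D : PerfectMatchingGraph M F} {n : ℕ} {k : Type*} [CommRing k]

theorem isStep_iff {e : M} {x y : D.Monomial n} :
    IsStep e x y ↔ x.1 e = false ∧ y.1 e = true ∧ (∀ e', e' ≠ e → y.1 e' = x.1 e') ∧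
      ∀ p, D.circ x.1 p ≠ D.strand x.1 e false → D.circ x.1 p ≠ D.strand x.1 e true →
        y.2 (D.circ y.1 p) = x.2 (D.circ x.1 p) :=
  ⟨fun h => ⟨h.source, h.target, h.agreeOff, fun p hp hp' => h.away p (not_or.2 ⟨hp, hp'⟩)⟩,
    fun h => ⟨h.1, h.2.1, h.2.2.1, fun p hp => h.2.2.2 p (not_or.1 hp).1 (not_or.1 hp).2⟩⟩

theorem edgeCoeff_eq_tableCoeff (s : k) (e : M) (x y : D.Monomial n) :
    D.edgeCoeff s e x y = tableCoeff (truncatedTable n s) e x y := by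
  classical
  exact (if_congr isStep_iff rfl rfl).symm

variable [Finite M] [Finite F]

/-- The degree of a monomial, where `x^a` has the degree `m - a` with `m = ⌊n/2⌋`, without the shift
by the number of `1`-smoothings. -/
noncomputable def degree (x : D.Monomial n) : ℤ :=
  ∑ c, ((n / 2 : ℕ) - (x.2 c : ℕ) : ℤ)

/-- On all circles together, the exponents of `x` and `y` have to be compared only at `e`: they
enter the entries of the tables through an equation `a = b` or a congruence `a ≡ b`, and the
degrees through the difference `b - a`. -/
theorem IsStep.exists_coeff_eq {e : M} {x y : D.Monomial n} (h : IsStep e x y) (s : k) :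
    ∃ (a b : ℕ) (r : k), a < b + n ∧ degree y = degree x - (n / 2 : ℕ) + (b - a) ∧
      D.edgeCoeff s e x y = (if a = b then r else 0) ∧
      tableCoeff (cyclicTable n s) e x y = if a ≡ b [MOD n] then r else 0 := by
  classical
  have degree_x : degree x = _ := sum_circle x.1 e fun c => ((n / 2 : ℕ) - (x.2 c : ℕ) : ℤ)
  have degree_y : degree y = _ := sum_circle y.1 e fun c => ((n / 2 : ℕ) - (y.2 c : ℕ) : ℤ)
  have away := sum_away h.agreeOff (g := fun c => ((n / 2 : ℕ) - (x.2 c : ℕ) : ℤ))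
    (g' := fun c => ((n / 2 : ℕ) - (y.2 c : ℕ) : ℤ)) fun p hp => by rw [h.away p hp]
  rw [edgeCoeff_eq_tableCoeff]
  by_cases hc : D.strand x.1 e false = D.strand x.1 e true
  · by_cases hd : D.strand y.1 e false = D.strand y.1 e true
    · refine ⟨y.2 (D.strand y.1 e false), x.2 (D.strand x.1 e false) + n / 2, s,
        by omega, ?_, ?_, ?_⟩
      · rw [if_neg (not_not.2 hc)] at degree_x
        rw [if_neg (not_not.2 hd)] at degree_y
        omega
      · simp [tableCoeff, h, hc, hd, truncatedTable, etaCoeff]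
      · simp [tableCoeff, h, hc, hd, cyclicTable]
    · refine ⟨y.2 (D.strand y.1 e false) + y.2 (D.strand y.1 e true),
        x.2 (D.strand x.1 e false) + 2 * (n / 2), 1, by omega, ?_, ?_, ?_⟩
      · rw [if_neg (not_not.2 hc)] at degree_x
        rw [if_pos hd] at degree_y
        omega
      · simp [tableCoeff, h, hc, hd, truncatedTable, comulCoeff]
      · simp [tableCoeff, h, hc, hd, cyclicTable]
  · have hd : D.strand y.1 e false = D.strand y.1 e true :=
      strand_eq_of_strand_ne h.agreeOff h.source h.target hc
    refine ⟨y.2 (D.strand y.1 e false),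
      x.2 (D.strand x.1 e false) + x.2 (D.strand x.1 e true), 1, by omega, ?_, ?_, ?_⟩
    · rw [if_pos hc] at degree_x
      rw [if_neg (not_not.2 hd)] at degree_y
      omega
    · simp [tableCoeff, h, hc, hd, truncatedTable, mulCoeff]
    · simp [tableCoeff, h, hc, hd, cyclicTable]

theorem degree_le_of_tableCoeff_cyclicTable_ne_zero {s : k} {e : M} {x y : D.Monomial n}
    (hxy : tableCoeff (cyclicTable n s) e x y ≠ 0) : degree x - (n / 2 : ℕ) ≤ degree y := by
  by_cases h : IsStep e x y
  · obtain ⟨a, b, r, hab, hdegree, -, hcyclic⟩ := h.exists_coeff_eq s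
    have le : a ≤ b := (ite_ne_right_iff.1 (hcyclic ▸ hxy)).1.le_of_lt_add hab
    omega
  · exact absurd (tableCoeff_of_not_isStep _ h) hxy

open Classical in
theorem edgeCoeff_eq_ite_degree (s : k) (e : M) (x y : D.Monomial n) :
    D.edgeCoeff s e x y =
      if degree y = degree x - (n / 2 : ℕ) then tableCoeff (cyclicTable n s) e x y else 0 := by
  by_cases h : IsStep e x y
  · obtain ⟨a, b, r, -, hdegree, htruncated, hcyclic⟩ := h.exists_coeff_eq s
    rw [htruncated, hcyclic]
    by_cases hab : a = b
    · rw [if_pos hab, if_pos (by omega), if_pos (hab ▸ Nat.ModEq.rfl)]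
    · rw [if_neg hab, if_neg (by omega)]
  · rw [edgeCoeff_eq_tableCoeff, tableCoeff_of_not_isStep _ h, tableCoeff_of_not_isStep _ h,
      ite_self]

theorem degree_of_edgeCoeff_ne_zero {s : k} {e : M} {x y : D.Monomial n}
    (h : D.edgeCoeff s e x y ≠ 0) : degree y = degree x - (n / 2 : ℕ) := by
  rw [edgeCoeff_eq_ite_degree] at h
  exact (ite_ne_right_iff.1 h).1

theorem sum_edgeCoeff_mul_edgeCoeff (s : k) (e e' : M) (x z : D.Monomial n) :
    ∑ y, D.edgeCoeff s e x y * D.edgeCoeff s e' y z =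
      if degree z = degree x - (n / 2 : ℕ) - (n / 2 : ℕ) then
        (D.tableMatrix (cyclicTable n s) e * D.tableMatrix (cyclicTable n s) e') x z else 0 := by
  split_ifs with hxz
  · refine Finset.sum_congr rfl fun y _ => ?_
    simp only [edgeCoeff_eq_ite_degree, tableMatrix, Matrix.of_apply]
    by_cases hxy : tableCoeff (cyclicTable n s) e x y = 0
    · simp [hxy]
    by_cases hyz : tableCoeff (cyclicTable n s) e' y z = 0
    · simp [hyz]
    have := degree_le_of_tableCoeff_cyclicTable_ne_zero hxy
    have := degree_le_of_tableCoeff_cyclicTable_ne_zero hyz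
    rw [if_pos (by omega), if_pos (by omega)]
  · refine Finset.sum_eq_zero fun y _ => ?_
    by_contra hy
    have := degree_of_edgeCoeff_ne_zero (left_ne_zero_of_mul hy)
    have := degree_of_edgeCoeff_ne_zero (right_ne_zero_of_mul hy)
    omega

end Degree

section Commute

open Polynomial

/-- `ℤ[X] / (X² - n)` embeds into `ℂ × ℂ`. -/
theorem aeval_eq_zero_of_sq_eq {k : Type*} [CommRing k] {n : ℕ} (hn : 0 < n) {p : ℤ[X]}
    (hp : ∀ t : ℂ, t ^ 2 = n → aeval t p = 0) {s : k} (hs : s ^ 2 = n) : aeval s p = 0 := by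
  have hmonic : (X ^ 2 - C (n : ℤ)).Monic := monic_X_pow_sub_C _ two_ne_zero
  have division := modByMonic_add_div p (X ^ 2 - C (n : ℤ))
  have degree_le : (p %ₘ (X ^ 2 - C (n : ℤ))).degree ≤ 1 :=
    Order.le_of_lt_succ ((degree_modByMonic_lt p hmonic).trans_eq (degree_X_pow_sub_C two_pos _))
  obtain ⟨a, b, hab⟩ := exists_eq_X_add_C_of_natDegree_le_one
    (natDegree_le_of_degree_le degree_le)
  have hroot (t : ℂ) (ht : t ^ 2 = n) : (a : ℂ) * t + b = 0 := by
    have h := hp t ht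
    rw [← division, hab] at h
    simpa [ht] using h
  obtain ⟨t, ht⟩ := IsAlgClosed.exists_pow_nat_eq (n : ℂ) two_pos
  have ht₀ : t ≠ 0 := by
    rintro rfl
    exact hn.ne (Nat.cast_injective (R := ℂ) (by simpa using ht))
  have hb : (b : ℂ) = 0 := by
    linear_combination (hroot t ht + hroot (-t) (by rw [neg_sq, ht])) / 2
  have ha : (a : ℂ) = 0 := by
    simpa [hb, ht₀] using hroot t ht
  rw [← division, hab, Int.cast_eq_zero.1 ha, Int.cast_eq_zero.1 hb]
  simp [hs]

variable {M F : Type} {D : PerfectMatchingGraph M F} {n : ℕ} {k : Type*} [CommRing k]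

theorem map_edgeCoeff {k' : Type*} [CommRing k'] (φ : k →+* k') (s : k) (e : M)
    (x y : D.Monomial n) : φ (D.edgeCoeff s e x y) = D.edgeCoeff (φ s) e x y := by
  simp only [edgeCoeff, mulCoeff, comulCoeff, etaCoeff]
  split_ifs <;> simp

theorem aeval_edgeCoeff (s : k) (e : M) (x y : D.Monomial n) :
    aeval s (D.edgeCoeff (X : ℤ[X]) e x y) = D.edgeCoeff s e x y := by
  simpa using map_edgeCoeff (aeval (R := ℤ) s).toRingHom X e x y

variable [Finite M] [Finite F]

theorem commute_tableMatrix_cyclicTable (hn : 0 < n) {s : ℂ} (hs : s ^ 2 = n) (e e' : M) :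
    Commute (D.tableMatrix (cyclicTable n s) e) (D.tableMatrix (cyclicTable n s) e') :=
  commute_tableMatrix (cyclicTableDiagonalization (Complex.isPrimitiveRoot_exp n hn.ne') hs
    (Nat.cast_ne_zero.2 hn.ne')) e e'

theorem sum_edgeCoeff_mul_edgeCoeff_comm (hn : 0 < n) {s : k} (hs : s ^ 2 = n) (e e' : M)
    (x z : D.Monomial n) :
    ∑ y, D.edgeCoeff s e x y * D.edgeCoeff s e' y z =
      ∑ y, D.edgeCoeff s e' x y * D.edgeCoeff s e y z := by
  have descent := aeval_eq_zero_of_sq_eq hn (p :=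
    ∑ y, D.edgeCoeff X e x y * D.edgeCoeff X e' y z -
      ∑ y, D.edgeCoeff X e' x y * D.edgeCoeff X e y z) (fun t ht => ?_) hs
  · simpa only [map_sub, map_sum, map_mul, aeval_edgeCoeff, sub_eq_zero] using descent
  · simp only [map_sub, map_sum, map_mul, aeval_edgeCoeff, sub_eq_zero]
    rw [sum_edgeCoeff_mul_edgeCoeff, sum_edgeCoeff_mul_edgeCoeff,
      (commute_tableMatrix_cyclicTable hn ht e e').eq]

theorem edgeMap_apply (s : k) (e : M) (w : D.Monomial n → k) (y : D.Monomial n) :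
    D.edgeMap n s e w y = ∑ x, D.edgeCoeff s e x y * w x :=
  rfl

theorem commute_edgeMap (hn : 0 < n) {s : k} (hs : s ^ 2 = n) (e e' : M) :
    Commute (D.edgeMap n s e) (D.edgeMap n s e') := by
  have mul_eq (e e' : M) : D.edgeMap n s e * D.edgeMap n s e' = Matrix.mulVecLin
      (Matrix.of fun z x => ∑ y, D.edgeCoeff s e' x y * D.edgeCoeff s e y z) := by
    rw [Module.End.mul_eq_comp, edgeMap, edgeMap, ← Matrix.mulVecLin_mul]
    congr 1
    ext z x
    exact Finset.sum_congr rfl fun y _ => mul_comm _ _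
  rw [commute_iff_eq, mul_eq, mul_eq]
  simp only [sum_edgeCoeff_mul_edgeCoeff_comm hn hs e e']

theorem exists_of_edgeMap_ne_zero {s : k} {e : M} {w : D.Monomial n → k} {y : D.Monomial n}
    (h : D.edgeMap n s e w y ≠ 0) :
    ∃ x, w x ≠ 0 ∧ IsStep e x y ∧ degree y = degree x - (n / 2 : ℕ) := by
  obtain ⟨x, -, hx⟩ := Finset.exists_ne_zero_of_sum_ne_zero (edgeMap_apply s e w y ▸ h)
  have hxy := left_ne_zero_of_mul hx
  refine ⟨x, right_ne_zero_of_mul hx, ?_, degree_of_edgeCoeff_ne_zero hxy⟩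
  by_contra hstep
  exact hxy ((edgeCoeff_eq_tableCoeff s e x y).trans (tableCoeff_of_not_isStep _ hstep))

end Commute

end PerfectMatchingGraph

/-! ## Composites along paths of the hypercube -/

namespace PerfectMatchingGraph

variable {M F : Type} (D : PerfectMatchingGraph M F) [Finite M] [Finite F] {k : Type*} [CommRing k]

/-- The composite of the edge maps in the directions of the matching edges in `l`, where the last
element of `l` is the direction of the first edge of the path. -/
noncomputable def edgeMapList (n : ℕ) (s : k) (l : List M) : Module.End k (D.Monomial n → k) :=
  (l.map (D.edgeMap n s)).prod

variable {n : ℕ} {s : k}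

theorem edgeMapList_cons (e : M) (l : List M) :
    D.edgeMapList n s (e :: l) = D.edgeMap n s e * D.edgeMapList n s l :=
  List.prod_cons

theorem edgeMapList_perm (hn : 0 < n) (hs : s ^ 2 = n) {l l' : List M} (h : l.Perm l') :
    D.edgeMapList n s l = D.edgeMapList n s l' :=
  (h.map _).prod_eq' (List.pairwise_map.2 (List.pairwise_of_forall (commute_edgeMap hn hs)))

theorem commute_edgeMapList (hn : 0 < n) (hs : s ^ 2 = n) (l l' : List M) :
    Commute (D.edgeMapList n s l) (D.edgeMapList n s l') := by
  refine Commute.list_prod_left _ _ fun f hf => Commute.list_prod_right _ _ fun g hg => ?_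
  obtain ⟨e, -, rfl⟩ := List.mem_map.1 hf
  obtain ⟨e', -, rfl⟩ := List.mem_map.1 hg
  exact commute_edgeMap hn hs e e'

variable {D}

theorem exists_of_edgeMapList_ne_zero {l : List M} {w : D.Monomial n → k} {y : D.Monomial n}
    (h : D.edgeMapList n s l w y ≠ 0) :
    ∃ x, w x ≠ 0 ∧ (∀ e ∈ l, x.1 e = false ∧ y.1 e = true) ∧ (∀ e ∉ l, y.1 e = x.1 e) ∧
      degree y = degree x - l.length * (n / 2 : ℕ) := by
  induction l generalizing y with
  | nil => exact ⟨y, h, by simp, by simp, by simp⟩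
  | cons e l ih =>
    rw [edgeMapList_cons] at h
    obtain ⟨z, hz, step, degree_step⟩ := exists_of_edgeMap_ne_zero h
    obtain ⟨x, hx, on_list, off_list, degree_list⟩ := ih hz
    refine ⟨x, hx, fun e' he' => ?_, fun e' he' => ?_, ?_⟩
    · by_cases hl : e' ∈ l
      · refine ⟨(on_list e' hl).1, ?_⟩
        by_cases hee' : e' = e
        · rw [hee', step.target]
        · rw [step.agreeOff e' hee', (on_list e' hl).2]
      · obtain rfl := (List.mem_cons.1 he').resolve_right hl
        exact ⟨(off_list e' hl).symm.trans step.source, step.target⟩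
    · rw [List.mem_cons, not_or] at he'
      rw [step.agreeOff e' he'.1, off_list e' he'.2]
    · rw [degree_step, degree_list, List.length_cons]
      push_cast
      ring

end PerfectMatchingGraph

namespace TrivalentRibbonGraph

open PerfectMatchingGraph

section HalfEdges

variable {V H L : Type} (Γ : TrivalentRibbonGraph V H L)

theorem vert_rot (h : H) : Γ.vert (Γ.rot h) = Γ.vert h :=
  (Γ.vert_eq_iff _ _).2 (Equiv.Perm.sameCycle_apply_left.2 (Equiv.Perm.SameCycle.refl _ _))

/-- The three half-edges at a vertex, with that used last by `vertexMap` in front. -/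
noncomputable def star (v : V) : List H :=
  let h := (Γ.exists_vert_eq v).choose
  [Γ.rot (Γ.rot h), Γ.rot h, h]

theorem card_filter_vert_eq [Fintype H] [DecidableEq V] (v : V) :
    (Finset.univ.filter fun h => Γ.vert h = v).card = 3 := by
  rw [← Γ.trivalent v, Nat.card_eq_fintype_card, Fintype.card_subtype]

theorem isCycleOn_rot [Fintype H] [DecidableEq V] (v : V) :
    Γ.rot.IsCycleOn (Finset.univ.filter fun h => Γ.vert h = v) := by
  rw [Finset.coe_filter_univ]
  refine ⟨⟨fun h hh => (Γ.vert_rot h).trans hh, Γ.rot.injective.injOn, fun h hh =>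
    ⟨Γ.rot.symm h, ?_, Γ.rot.apply_symm_apply h⟩⟩, fun h hh h' hh' =>
    (Γ.vert_eq_iff h h').1 (hh.trans hh'.symm)⟩
  rwa [Set.mem_ofPred_eq, ← vert_rot, Equiv.apply_symm_apply]

variable [Finite H]

theorem rot_pow_apply_eq_iff (h : H) (j : ℕ) : (Γ.rot ^ j) h = h ↔ 3 ∣ j := by
  classical
  have := Fintype.ofFinite H
  rw [← Γ.card_filter_vert_eq (Γ.vert h)]
  exact (Γ.isCycleOn_rot (Γ.vert h)).pow_apply_eq (by simp)

theorem nodup_star (v : V) : (Γ.star v).Nodup := by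
  have h₁ (h : H) : Γ.rot h ≠ h := fun h' => by simpa [h'] using Γ.rot_pow_apply_eq_iff h 1
  have h₂ (h : H) : Γ.rot (Γ.rot h) ≠ h := fun h' => by
    simpa [pow_two, h'] using Γ.rot_pow_apply_eq_iff h 2
  simp [star, h₁, h₂]

theorem mem_star {v : V} {h : H} : h ∈ Γ.star v ↔ Γ.vert h = v := by
  classical
  have := Fintype.ofFinite H
  have hv := (Γ.exists_vert_eq v).choose_spec
  constructor
  · simp only [star, List.mem_cons, List.not_mem_nil, or_false]
    rintro (rfl | rfl | rfl) <;> simp only [vert_rot, hv]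
  · intro hh
    obtain ⟨j, hj, rfl⟩ := (Γ.isCycleOn_rot v).exists_pow_eq
      ((Finset.mem_filter_univ _).2 hv) ((Finset.mem_filter_univ _).2 hh)
    rw [Γ.card_filter_vert_eq v] at hj
    interval_cases j <;> simp [star, pow_two]

theorem perm_star {v : V} {l : List H} (hl : l.Nodup) (hv : ∀ h ∈ l, Γ.vert h = v)
    (h3 : l.length = 3) : l.Perm (Γ.star v) :=
  (List.subperm_of_subset hl fun h hh => Γ.mem_star.2 (hv h hh)).perm_of_length_le h3.ge

end HalfEdges

section VertexMap

variable {V H L : Type} (Γ : TrivalentRibbonGraph V H L)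

theorem blowupState_injective : Function.Injective Γ.blowupState := by
  intro ν ν' h
  funext v
  obtain ⟨a, rfl⟩ := Γ.exists_vert_eq v
  exact congrFun h a

theorem toBlowup_injective (n : ℕ) : Function.Injective (Γ.toBlowup n) := by
  rintro ⟨ν, a⟩ ⟨ν', a'⟩ h
  obtain rfl : ν = ν' := Γ.blowupState_injective (congrArg Sigma.fst h)
  simpa [toBlowup] using h

theorem exists_toBlowup_eq {n : ℕ} {y : Γ.bubbledBlowup.Monomial n} {ν : V → Bool}
    (h : y.1 = Γ.blowupState ν) : ∃ x, Γ.toBlowup n x = y ∧ x.1 = ν := by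
  obtain ⟨α, a⟩ := y
  subst h
  exact ⟨⟨ν, a⟩, rfl, rfl⟩

variable [Finite H] [Finite L] {k : Type*} [CommRing k] {n : ℕ}

theorem threeStep_apply (s : k) (h₁ h₂ h₃ : H) (w : Γ.VertexMonomial n → k)
    (y : Γ.VertexMonomial n) : Γ.threeStep n s h₁ h₂ h₃ w y =
      Γ.bubbledBlowup.edgeMapList n s [h₃, h₂, h₁] (Function.extend (Γ.toBlowup n) w 0)
        (Γ.toBlowup n y) :=
  rfl

theorem vertexMap_apply (s : k) (v : V) (w : Γ.VertexMonomial n → k) (y : Γ.VertexMonomial n) :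
    Γ.vertexMap n s v w y =
      Γ.bubbledBlowup.edgeMapList n s (Γ.star v) (Function.extend (Γ.toBlowup n) w 0)
        (Γ.toBlowup n y) :=
  rfl

theorem threeStep_eq_vertexMap (hn : 0 < n) {s : k} (hs : s ^ 2 = n) {v : V} {h₁ h₂ h₃ : H}
    (hv₁ : Γ.vert h₁ = v) (hv₂ : Γ.vert h₂ = v) (hv₃ : Γ.vert h₃ = v)
    (h₁₂ : h₁ ≠ h₂) (h₁₃ : h₁ ≠ h₃) (h₂₃ : h₂ ≠ h₃) :
    Γ.threeStep n s h₁ h₂ h₃ = Γ.vertexMap n s v := by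
  have perm : [h₃, h₂, h₁].Perm (Γ.star v) :=
    Γ.perm_star (by simp [h₁₂.symm, h₁₃.symm, h₂₃.symm]) (by simp [hv₁, hv₂, hv₃]) rfl
  ext1 w
  funext y
  rw [threeStep_apply, vertexMap_apply, edgeMapList_perm _ hn hs perm]

theorem exists_of_edgeMapList_star_ne_zero [DecidableEq V] {s : k} {v : V}
    {w : Γ.VertexMonomial n → k} {y : Γ.bubbledBlowup.Monomial n}
    (h : Γ.bubbledBlowup.edgeMapList n s (Γ.star v) (Function.extend (Γ.toBlowup n) w 0) y ≠ 0) :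
    ∃ x y', w x ≠ 0 ∧ Γ.toBlowup n y' = y ∧ x.1 v = false ∧ y'.1 = Function.update x.1 v true ∧
      degree y = degree (Γ.toBlowup n x) - 3 * (n / 2 : ℕ) := by
  obtain ⟨x', hx', on_star, off_star, hdegree⟩ := exists_of_edgeMapList_ne_zero h
  obtain ⟨x, rfl⟩ : ∃ x, Γ.toBlowup n x = x' := by
    by_contra hne
    exact hx' (Function.extend_apply' _ _ _ hne)
  rw [(Γ.toBlowup_injective n).extend_apply] at hx'
  have state_eq : y.1 = Γ.blowupState (Function.update x.1 v true) := by
    funext a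
    by_cases ha : Γ.vert a = v
    · rw [blowupState, ha, Function.update_self, (on_star a (Γ.mem_star.2 ha)).2]
    · rw [blowupState, Function.update_of_ne ha, off_star a (mt Γ.mem_star.1 ha)]
      rfl
  obtain ⟨y', hy', hy'₁⟩ := Γ.exists_toBlowup_eq state_eq
  obtain ⟨a, rfl⟩ := Γ.exists_vert_eq v
  exact ⟨x, y', hx', hy', (on_star a (Γ.mem_star.2 rfl)).1, hy'₁, hdegree⟩

theorem exists_of_vertexMap_ne_zero [DecidableEq V] {s : k} {v : V}
    {w : Γ.VertexMonomial n → k} {y : Γ.VertexMonomial n} (hy : Γ.vertexMap n s v w y ≠ 0) :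
    ∃ x, w x ≠ 0 ∧ x.1 v = false ∧ y.1 = Function.update x.1 v true ∧
      degree (Γ.toBlowup n y) = degree (Γ.toBlowup n x) - 3 * (n / 2 : ℕ) := by
  obtain ⟨x, y', hx, hy', source, target, hdegree⟩ := Γ.exists_of_edgeMapList_star_ne_zero hy
  rw [Γ.toBlowup_injective n hy'] at target
  exact ⟨x, hx, source, target, hdegree⟩

theorem extend_vertexMap (s : k) (v : V) (w : Γ.VertexMonomial n → k) :
    Function.extend (Γ.toBlowup n) (Γ.vertexMap n s v w) 0 =
      Γ.bubbledBlowup.edgeMapList n s (Γ.star v) (Function.extend (Γ.toBlowup n) w 0) := by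
  classical
  funext y
  by_cases hy : ∃ x, Γ.toBlowup n x = y
  · obtain ⟨x, rfl⟩ := hy
    rw [(Γ.toBlowup_injective n).extend_apply, vertexMap_apply]
  · rw [Function.extend_apply' _ _ _ hy]
    by_contra h
    obtain ⟨-, y', -, hy', -⟩ := Γ.exists_of_edgeMapList_star_ne_zero (Ne.symm h)
    exact hy ⟨y', hy'⟩

theorem vertexMap_comm (hn : 0 < n) {s : k} (hs : s ^ 2 = n) (u v : V)
    (w : Γ.VertexMonomial n → k) :
    Γ.vertexMap n s u (Γ.vertexMap n s v w) = Γ.vertexMap n s v (Γ.vertexMap n s u w) := by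
  refine Function.extend_injective (Γ.toBlowup_injective n) 0 ?_
  simp only [extend_vertexMap]
  rw [← Module.End.mul_apply, (Γ.bubbledBlowup.commute_edgeMapList hn hs _ _).eq,
    Module.End.mul_apply]

theorem vertexMap_vertexMap_self (s : k) (v : V) (w : Γ.VertexMonomial n → k) :
    Γ.vertexMap n s v (Γ.vertexMap n s v w) = 0 := by
  classical
  funext y
  by_contra h
  obtain ⟨x, hx, source, -⟩ := Γ.exists_of_vertexMap_ne_zero h
  obtain ⟨z, -, -, target, -⟩ := Γ.exists_of_vertexMap_ne_zero hx
  simp [target] at source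

end VertexMap

end TrivalentRibbonGraph

/-! ## The differential -/

namespace TrivalentRibbonGraph

section Sign

variable {V : Type} {N N' : ℕ} (o : V ≃ Fin N) (o' : V ≃ Fin N')

theorem edgeSign_mul_self (ν : V → Bool) (v : V) : edgeSign o ν v * edgeSign o ν v = 1 := by
  rw [edgeSign, ← mul_pow, neg_one_mul, neg_neg, one_pow]

theorem inversion_mul_inversion {u v : V} (h : u ≠ v) :
    ((if o v < o u ∧ o' u < o' v then -1 else 1) * if o u < o v ∧ o' v < o' u then -1 else 1 : ℤ) =
      (if o u < o v then -1 else 1) * if o' u < o' v then -1 else 1 := by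
  rcases lt_or_gt_of_ne (o.injective.ne h) with h₁ | h₁ <;>
    rcases lt_or_gt_of_ne (o'.injective.ne h) with h₂ | h₂ <;>
    simp [h₁, h₂, h₁.not_gt, h₂.not_gt]

section Fintype

variable [Fintype V]

/-- The vertices with a `1`-smoothing. -/
def ones (ν : V → Bool) : Finset V :=
  Finset.univ.filter fun v => ν v = true

theorem mem_ones {ν : V → Bool} {v : V} : v ∈ ones ν ↔ ν v = true :=
  Finset.mem_filter_univ v

theorem notMem_ones {ν : V → Bool} {v : V} : v ∉ ones ν ↔ ν v = false := by
  simp [mem_ones]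

theorem ones_update [DecidableEq V] (ν : V → Bool) (v : V) :
    ones (Function.update ν v true) = insert v (ones ν) := by
  ext u
  by_cases h : u = v <;> simp [mem_ones, h]

theorem weight_eq_card_ones (ν : V → Bool) : weight ν = (ones ν).card := by
  rw [weight, ones, Nat.card_eq_fintype_card, Fintype.card_subtype]

theorem edgeSign_eq_prod (ν : V → Bool) (v : V) :
    edgeSign o ν v = ∏ u ∈ ones ν, if o u < o v then -1 else 1 := by
  classical
  rw [edgeSign, Finset.prod_ite, Finset.prod_const, Finset.prod_const_one, mul_one, ones,
    Finset.filter_filter, Nat.card_eq_fintype_card, Fintype.card_subtype]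
  simp only [and_comm]

/-- The sign comparing two numberings of the vertices: the parity of the number of inversions
among the vertices with a `1`-smoothing. -/
def inversionSign (ν : V → Bool) : ℤ :=
  ∏ u ∈ ones ν, ∏ v ∈ ones ν, if o u < o v ∧ o' v < o' u then -1 else 1

theorem inversionSign_mul_self (ν : V → Bool) :
    inversionSign o o' ν * inversionSign o o' ν = 1 := by
  simp only [inversionSign, ← Finset.prod_mul_distrib]
  exact Finset.prod_eq_one fun u _ => Finset.prod_eq_one fun v _ => by split_ifs <;> rfl

/-- `inversionSign` is a cochain on the hypercube whose coboundary compares the signs of the edges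
for the two numberings. -/
theorem inversionSign_update [DecidableEq V] {ν : V → Bool} {v : V} (h : ν v = false) :
    inversionSign o o' (Function.update ν v true) =
      inversionSign o o' ν * (edgeSign o ν v * edgeSign o' ν v) := by
  have hv := notMem_ones.2 h
  have new_pairs : (∏ u ∈ ones ν, if o v < o u ∧ o' u < o' v then -1 else 1 : ℤ) *
      (∏ u ∈ ones ν, if o u < o v ∧ o' v < o' u then -1 else 1) =
        edgeSign o ν v * edgeSign o' ν v := by
    rw [edgeSign_eq_prod, edgeSign_eq_prod, ← Finset.prod_mul_distrib, ← Finset.prod_mul_distrib]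
    exact Finset.prod_congr rfl fun u hu =>
      inversion_mul_inversion o o' (ne_of_mem_of_not_mem hu hv)
  simp only [inversionSign, ones_update, Finset.prod_insert hv, Finset.prod_mul_distrib]
  rw [if_neg (fun hlt => lt_irrefl _ hlt.1), one_mul, ← mul_assoc, new_pairs, mul_comm]

end Fintype

theorem weight_update [Finite V] [DecidableEq V] {ν : V → Bool} {v : V} (h : ν v = false) :
    weight (Function.update ν v true) = weight ν + 1 := by
  have := Fintype.ofFinite V
  rw [weight_eq_card_ones, weight_eq_card_ones, ones_update,
    Finset.card_insert_of_notMem (notMem_ones.2 h)]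

theorem edgeSign_update [Finite V] [DecidableEq V] {ν : V → Bool} {u v : V}
    (h : ν u = false) : edgeSign o (Function.update ν u true) v =
      (if o u < o v then -1 else 1) * edgeSign o ν v := by
  have := Fintype.ofFinite V
  rw [edgeSign_eq_prod, edgeSign_eq_prod, ones_update, Finset.prod_insert (notMem_ones.2 h)]

end Sign

variable {V H L : Type} (Γ : TrivalentRibbonGraph V H L)

/-- Multiplication of each monomial by a number depending on its state. -/
def scale (k : Type*) [CommRing k] (n : ℕ) (σ : (V → Bool) → ℤ) :
    (Γ.VertexMonomial n → k) →ₗ[k] (Γ.VertexMonomial n → k) :=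
  LinearMap.pi fun x => σ x.1 • LinearMap.proj (R := k) (φ := fun _ => k) x

theorem scale_apply {k : Type*} [CommRing k] {n : ℕ} (σ : (V → Bool) → ℤ)
    (w : Γ.VertexMonomial n → k) (x : Γ.VertexMonomial n) :
    Γ.scale k n σ w x = σ x.1 • w x :=
  rfl

theorem scale_scale {k : Type*} [CommRing k] {n : ℕ} (σ τ : (V → Bool) → ℤ)
    (w : Γ.VertexMonomial n → k) :
    Γ.scale k n σ (Γ.scale k n τ w) = Γ.scale k n (fun ν => σ ν * τ ν) w :=
  funext fun x => smul_smul (σ x.1) (τ x.1) (w x)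

variable [Finite H] [Finite L] {k : Type*} [CommRing k] {n : ℕ}

theorem scale_vertexMap [DecidableEq V] (s : k) {σ τ : (V → Bool) → ℤ} {v : V}
    (h : ∀ ν, ν v = false → σ (Function.update ν v true) = τ ν) (w : Γ.VertexMonomial n → k) :
    Γ.scale k n σ (Γ.vertexMap n s v w) = Γ.vertexMap n s v (Γ.scale k n τ w) := by
  funext y
  rw [scale_apply, ← Pi.smul_apply, ← map_zsmul, ← sub_eq_zero, ← Pi.sub_apply, ← map_sub]
  by_contra hy
  obtain ⟨x, hx, source, target, -⟩ := Γ.exists_of_vertexMap_ne_zero hy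
  refine hx ?_
  rw [Pi.sub_apply, Pi.smul_apply, scale_apply, target, h x.1 source, sub_self]

theorem qDegree_eq (x : Γ.VertexMonomial n) : Γ.qDegree x =
    PerfectMatchingGraph.degree (Γ.toBlowup n x) + 3 * (n / 2 : ℕ) * (weight x.1 : ℤ) :=
  rfl

theorem scale_mem_chain (σ : (V → Bool) → ℤ) {i j : ℤ} {w : Γ.VertexMonomial n → k}
    (hw : w ∈ Γ.chain n k i j) : Γ.scale k n σ w ∈ Γ.chain n k i j := fun x hx => by
  rw [scale_apply, hw x hx, smul_zero]

theorem vertexMap_mem_chain [Finite V] (s : k) (v : V) {i j : ℤ} {w : Γ.VertexMonomial n → k}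
    (hw : w ∈ Γ.chain n k i j) : Γ.vertexMap n s v w ∈ Γ.chain n k (i + 1) j := by
  classical
  intro y hy
  by_contra hne
  obtain ⟨x, hx, source, target, hdegree⟩ := Γ.exists_of_vertexMap_ne_zero hne
  obtain ⟨hom_x, q_x⟩ := not_imp_comm.1 (hw x) hx
  have weight_y : weight y.1 = weight x.1 + 1 := by rw [target, weight_update source]
  refine hy ⟨?_, ?_⟩
  · rw [homDegree, weight_y, ← hom_x, homDegree, Nat.cast_succ]
  · rw [qDegree_eq, weight_y, hdegree, ← q_x, qDegree_eq]
    push_cast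
    ring

theorem signed_vertexMap_vertexMap [Finite V] {N : ℕ} (o : V ≃ Fin N) (s : k) (u v : V)
    (w : Γ.VertexMonomial n → k) :
    Γ.vertexMap n s v (Γ.scale k n (fun ν => edgeSign o ν v)
      (Γ.vertexMap n s u (Γ.scale k n (fun ν => edgeSign o ν u) w))) =
    (if o u < o v then -1 else 1 : ℤ) • Γ.vertexMap n s v (Γ.vertexMap n s u
      (Γ.scale k n (fun ν => edgeSign o ν v * edgeSign o ν u) w)) := by
  classical
  rw [Γ.scale_vertexMap s fun ν hν => edgeSign_update o hν, scale_scale, ← map_zsmul, ← map_zsmul]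
  congr 2
  funext x
  simp only [scale_apply, Pi.smul_apply, smul_smul, mul_assoc]

variable [Fintype V] {N : ℕ} (o : V ≃ Fin N)

theorem differential_apply (s : k) (w : Γ.VertexMonomial n → k) :
    Γ.differential n s o w =
      ∑ v, Γ.vertexMap n s v (Γ.scale k n (fun ν => edgeSign o ν v) w) := by
  rw [differential, LinearMap.sum_apply]
  rfl

theorem differential_mem_chain (s : k) {i j : ℤ} {w : Γ.VertexMonomial n → k}
    (hw : w ∈ Γ.chain n k i j) : Γ.differential n s o w ∈ Γ.chain n k (i + 1) j := by
  rw [differential_apply]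
  exact Submodule.sum_mem _ fun v _ => Γ.vertexMap_mem_chain s v (Γ.scale_mem_chain _ hw)

theorem differential_differential (hn : 0 < n) {s : k} (hs : s ^ 2 = n)
    (w : Γ.VertexMonomial n → k) : Γ.differential n s o (Γ.differential n s o w) = 0 := by
  simp only [differential_apply, map_sum, signed_vertexMap_vertexMap]
  rw [← Finset.sum_product']
  refine Finset.sum_involution (fun p _ => p.swap) ?_ ?_ (fun p _ => Finset.mem_univ _)
    fun p _ => p.swap_swap
  · rintro ⟨v, u⟩ -
    simp only [Prod.fst_swap, Prod.snd_swap]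
    rw [Γ.vertexMap_comm hn hs u v]
    simp only [mul_comm (edgeSign o _ u)]
    rw [← add_smul]
    rcases lt_trichotomy (o u) (o v) with h | h | h
    · simp [h, h.not_gt]
    · rw [o.injective h, vertexMap_vertexMap_self, smul_zero]
    · simp [h, h.not_gt]
  · rintro ⟨v, u⟩ - hne h
    obtain rfl : u = v := congrArg Prod.fst h
    exact hne (by rw [vertexMap_vertexMap_self, smul_zero])

end TrivalentRibbonGraph

/-! ## Invariance -/

theorem exists_equiv_of_rel {α β : Type*} {R : α → β → Prop} (total : Relator.BiTotal R)
    (unique : Relator.BiUnique R) : ∃ f : α ≃ β, ∀ a, R a (f a) := by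
  choose f hf using total.1
  choose g hg using total.2
  exact ⟨⟨f, g, fun a => unique.1 (hg (f a)) (hf a), fun b => unique.2 (hf (g b)) (hg b)⟩, hf⟩

namespace PerfectMatchingGraph

/-- The bijection of half-edges which relabels the matching edges by `f` and interchanges the two
sides of those matching edges which are marked by `flip`. -/
def relabelSides {M M' : Type} (f : M ≃ M') (flip : M → Bool) :
    M × Bool × Bool ≃ M' × Bool × Bool where
  toFun p := (f p.1, p.2.1, xor p.2.2 (flip p.1))
  invFun p := (f.symm p.1, p.2.1, xor p.2.2 (flip (f.symm p.1)))
  left_inv p := by simp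
  right_inv p := by simp

variable {M F M' F' : Type}

/-- An isomorphism of perfect matching graphs which may interchange the two sides of some
matching edges.  This does not affect whether a smoothing is a `0`- or a `1`-smoothing. -/
structure Iso (D : PerfectMatchingGraph M F) (D' : PerfectMatchingGraph M' F') where
  onEdge : M ≃ M'
  onFree : F ≃ F'
  flip : M → Bool
  map_join : ∀ p, D'.join (relabelSides onEdge flip p) = relabelSides onEdge flip (D.join p)

open Classical in
/-- Exchanging the two sides of the matching edge does not change the entry, as `m` is commutative
and `Δ` is cocommutative. -/
theorem IsStep.edgeCoeff_eq {D : PerfectMatchingGraph M F} [Finite M] {k : Type*} [CommRing k]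
    {n : ℕ} (s : k) {e : M} {x y : D.Monomial n} (h : IsStep e x y) (b : Bool) :
    D.edgeCoeff s e x y =
      if D.strand x.1 e b ≠ D.strand x.1 e !b then
        mulCoeff k (x.2 (D.strand x.1 e b)) (x.2 (D.strand x.1 e !b)) (y.2 (D.strand y.1 e b))
      else if D.strand y.1 e b ≠ D.strand y.1 e !b then
        comulCoeff k (x.2 (D.strand x.1 e b)) (y.2 (D.strand y.1 e b)) (y.2 (D.strand y.1 e !b))
      else etaCoeff s (x.2 (D.strand x.1 e b)) (y.2 (D.strand y.1 e b)) := by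
  rw [edgeCoeff_eq_tableCoeff, tableCoeff, if_pos h]
  cases b
  · rfl
  have merge : D.strand x.1 e false ≠ D.strand x.1 e true →
      D.strand y.1 e false = D.strand y.1 e true :=
    strand_eq_of_strand_ne h.agreeOff h.source h.target
  by_cases hc : D.strand x.1 e false = D.strand x.1 e true
  · by_cases hd : D.strand y.1 e false = D.strand y.1 e true
    · simp [truncatedTable, hc, hd]
    · simp [truncatedTable, hc, hd, Ne.symm hd, comulCoeff, add_comm]
  · simp [truncatedTable, hc, Ne.symm hc, merge hc, mulCoeff, add_comm]

namespace Iso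

variable {D : PerfectMatchingGraph M F} {D' : PerfectMatchingGraph M' F'}

/-- The inverse isomorphism. -/
def symm (φ : D.Iso D') : D'.Iso D where
  onEdge := φ.onEdge.symm
  onFree := φ.onFree.symm
  flip := φ.flip ∘ φ.onEdge.symm
  map_join p := by
    change D.join ((relabelSides φ.onEdge φ.flip).symm p) =
      (relabelSides φ.onEdge φ.flip).symm (D'.join p)
    rw [Equiv.eq_symm_apply, ← φ.map_join, Equiv.apply_symm_apply]

variable (φ : D.Iso D')

/-- The bijection of the points. -/
def onPoint : D.Point ≃ D'.Point :=
  Equiv.sumCongr (relabelSides φ.onEdge φ.flip) φ.onFree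

theorem symm_onPoint : φ.symm.onPoint = φ.onPoint.symm :=
  Equiv.ext <| Sum.rec (fun _ => rfl) fun _ => rfl

/-- The states `α` and `α'` correspond to each other. -/
def StateRel (α : M → Bool) (α' : M' → Bool) : Prop := ∀ e, α' (φ.onEdge e) = α e

variable {φ} {α : M → Bool} {α' : M' → Bool}

namespace StateRel

theorem symm (h : φ.StateRel α α') : φ.symm.StateRel α' α := fun e => by
  rw [← h]
  exact congrArg α' (φ.onEdge.apply_symm_apply e)

theorem arc (h : φ.StateRel α α') {p q : D.Point} (hpq : D.Arc α p q) :
    D'.Arc α' (φ.onPoint p) (φ.onPoint q) := by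
  rcases hpq with p | ⟨e, b⟩
  · have join := Arc.join (D := D') (α := α') (relabelSides φ.onEdge φ.flip p)
    rwa [φ.map_join] at join
  · have smoothing := Arc.smoothing (D := D') (α := α') (φ.onEdge e) (xor b (φ.flip e))
    rwa [h e, Bool.xor_right_comm] at smoothing

/-- The bijection of the circles of corresponding states. -/
def onCircle (h : φ.StateRel α α') : D.Circle α ≃ D'.Circle α' :=
  Quot.congr φ.onPoint fun p q =>
    ⟨h.arc, fun hpq => by simpa [symm_onPoint] using h.symm.arc hpq⟩

theorem onCircle_circ (h : φ.StateRel α α') (p : D.Point) :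
    h.onCircle (D.circ α p) = D'.circ α' (φ.onPoint p) :=
  rfl

theorem onCircle_strand (h : φ.StateRel α α') (e : M) (b : Bool) :
    h.onCircle (D.strand α e b) = D'.strand α' (φ.onEdge e) (xor b (φ.flip e)) :=
  rfl

theorem strand_eq (h : φ.StateRel α α') (e : M) (b : Bool) :
    D'.strand α' (φ.onEdge e) b = h.onCircle (D.strand α e (xor b (φ.flip e))) := by
  rw [onCircle_strand, Bool.xor_assoc, Bool.xor_self, Bool.xor_false]

theorem through_iff (h : φ.StateRel α α') {e : M} {c : D.Circle α} :
    D'.Through α' (φ.onEdge e) (h.onCircle c) ↔ D.Through α e c := by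
  simp only [Through, h.strand_eq, h.onCircle.apply_eq_iff_eq]
  cases φ.flip e
  exacts [Iff.rfl, or_comm]

end StateRel

variable (φ) {n : ℕ}

/-- The monomials `x` and `x'` correspond to each other. -/
def MonomialRel (x : D.Monomial n) (x' : D'.Monomial n) : Prop :=
  φ.StateRel x.1 x'.1 ∧ ∀ p, x'.2 (D'.circ x'.1 (φ.onPoint p)) = x.2 (D.circ x.1 p)

variable {φ}

theorem StateRel.monomialRel_symm (h : φ.StateRel α α') (a : D.Circle α → Fin n) :
    φ.MonomialRel ⟨α, a⟩ ⟨α', a ∘ h.onCircle.symm⟩ := by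
  refine ⟨h, fun p => ?_⟩
  simp only [Function.comp_apply, ← h.onCircle_circ, Equiv.symm_apply_apply]

theorem StateRel.monomialRel (h : φ.StateRel α α') (a : D'.Circle α' → Fin n) :
    φ.MonomialRel ⟨α, a ∘ h.onCircle⟩ ⟨α', a⟩ :=
  ⟨h, fun _ => rfl⟩

namespace MonomialRel

variable {x y : D.Monomial n} {x' y' : D'.Monomial n}

theorem symm (h : φ.MonomialRel x x') : φ.symm.MonomialRel x' x :=
  ⟨h.1.symm, fun p => by rw [← h.2, symm_onPoint, Equiv.apply_symm_apply]⟩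

theorem left_unique (hx : φ.MonomialRel x x') (hy : φ.MonomialRel y x') : x = y := by
  obtain ⟨α, a⟩ := x
  obtain ⟨β, b⟩ := y
  obtain rfl : α = β := funext fun e => (hx.1 e).symm.trans (hy.1 e)
  congr 1
  funext c
  rw [← D.circ_out α c]
  exact (hx.2 _).symm.trans (hy.2 _)

theorem apply_onCircle (h : φ.MonomialRel x x') (c : D.Circle x.1) :
    x'.2 (h.1.onCircle c) = x.2 c := by
  rw [← D.circ_out x.1 c, StateRel.onCircle_circ, h.2]

theorem degree_eq [Finite M] [Finite F] [Finite M'] [Finite F'] (h : φ.MonomialRel x x') :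
    degree x' = degree x :=
  (Fintype.sum_equiv h.1.onCircle _ _ fun c => by rw [h.apply_onCircle]).symm

theorem isStep_iff (hx : φ.MonomialRel x x') (hy : φ.MonomialRel y y') {e : M} :
    IsStep (φ.onEdge e) x' y' ↔ IsStep e x y := by
  have agreeOff : AgreeOff (φ.onEdge e) x'.1 y'.1 ↔ AgreeOff e x.1 y.1 := by
    simp only [AgreeOff, φ.onEdge.surjective.forall, φ.onEdge.injective.ne_iff, hx.1 _, hy.1 _]
  have away : (∀ p, ¬ D'.Through x'.1 (φ.onEdge e) (D'.circ x'.1 p) →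
      y'.2 (D'.circ y'.1 p) = x'.2 (D'.circ x'.1 p)) ↔
      ∀ p, ¬ D.Through x.1 e (D.circ x.1 p) → y.2 (D.circ y.1 p) = x.2 (D.circ x.1 p) := by
    simp only [φ.onPoint.surjective.forall, hy.2, ← hx.1.onCircle_circ, hx.1.through_iff,
      hx.apply_onCircle]
  exact ⟨fun h => ⟨(hx.1 e).symm.trans h.source, (hy.1 e).symm.trans h.target,
      agreeOff.1 h.agreeOff, away.1 h.away⟩,
    fun h => ⟨(hx.1 e).trans h.source, (hy.1 e).trans h.target, agreeOff.2 h.agreeOff,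
      away.2 h.away⟩⟩

open Classical in
theorem edgeCoeff_eq [Finite M] {k : Type*} [CommRing k] (s : k) (hx : φ.MonomialRel x x')
    (hy : φ.MonomialRel y y') (e : M) :
    D'.edgeCoeff s (φ.onEdge e) x' y' = D.edgeCoeff s e x y := by
  by_cases h : IsStep e x y
  · rw [h.edgeCoeff_eq s (φ.flip e), edgeCoeff_eq_tableCoeff, tableCoeff,
      if_pos ((hx.isStep_iff hy).2 h)]
    simp only [truncatedTable, hx.1.strand_eq, hy.1.strand_eq, hx.apply_onCircle,
      hy.apply_onCircle, Equiv.apply_eq_iff_eq, ne_eq, Bool.false_xor, Bool.true_xor]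
  · rw [edgeCoeff_eq_tableCoeff, edgeCoeff_eq_tableCoeff, tableCoeff_of_not_isStep _ h,
      tableCoeff_of_not_isStep _ (mt (hx.isStep_iff hy).1 h)]

end MonomialRel

theorem biUnique_monomialRel : Relator.BiUnique (φ.MonomialRel (n := n)) :=
  ⟨fun _ _ _ => MonomialRel.left_unique, fun _ _ _ hx hy => hx.symm.left_unique hy.symm⟩

variable (φ n) in
theorem exists_onMonomial : ∃ B : D.Monomial n ≃ D'.Monomial n, ∀ x, φ.MonomialRel x (B x) := by
  refine exists_equiv_of_rel ⟨fun x => ?_, fun x' => ?_⟩ biUnique_monomialRel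
  · have h : φ.StateRel x.1 (x.1 ∘ φ.onEdge.symm) := fun e => by simp
    exact ⟨_, h.monomialRel_symm x.2⟩
  · have h : φ.StateRel (x'.1 ∘ φ.onEdge) x'.1 := fun e => rfl
    exact ⟨_, h.monomialRel x'.2⟩

variable [Finite M] [Finite F] [Finite M'] [Finite F'] {k : Type*} [CommRing k]

theorem edgeMapList_comp (s : k) {B : D.Monomial n ≃ D'.Monomial n}
    (hB : ∀ x, φ.MonomialRel x (B x)) (l : List M) (w : D'.Monomial n → k) :
    D.edgeMapList n s l (w ∘ B) = D'.edgeMapList n s (l.map φ.onEdge) w ∘ B := by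
  induction l with
  | nil => rfl
  | cons e l ih =>
    rw [List.map_cons, edgeMapList_cons, edgeMapList_cons, Module.End.mul_apply, ih]
    funext y
    rw [Function.comp_apply, Module.End.mul_apply, edgeMap_apply, edgeMap_apply]
    refine Fintype.sum_equiv B _ _ fun x => ?_
    rw [(hB x).edgeCoeff_eq s (hB y) e, Function.comp_apply]

end Iso

end PerfectMatchingGraph

namespace TrivalentRibbonGraph

open PerfectMatchingGraph

variable {V H L V' H' L' : Type} {Γ : TrivalentRibbonGraph V H L}
  {Γ' : TrivalentRibbonGraph V' H' L'}

theorem vert_rot_symm (Γ : TrivalentRibbonGraph V H L) (h : H) :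
    Γ.vert (Γ.rot.symm h) = Γ.vert h := by
  rw [← Γ.vert_rot, Equiv.apply_symm_apply]

namespace Equivalence

section BlowupIso

variable (φ : Γ.Equivalence Γ')

theorem map_rot_symm {h : H} (hf : φ.flip (Γ.vert h) = false) :
    Γ'.rot.symm (φ.onHalf h) = φ.onHalf (Γ.rot.symm h) := by
  rw [Equiv.symm_apply_eq, φ.map_rot _ (by rwa [Γ.vert_rot_symm]), Equiv.apply_symm_apply]

theorem map_rot_symm_flip {h : H} (hf : φ.flip (Γ.vert h) = true) :
    Γ'.rot.symm (φ.onHalf h) = φ.onHalf (Γ.rot h) := by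
  rw [Equiv.symm_apply_eq, φ.map_rot_flip h hf]

theorem rot_onHalf_flip {h : H} (hf : φ.flip (Γ.vert h) = true) :
    Γ'.rot (φ.onHalf h) = φ.onHalf (Γ.rot.symm h) := by
  simpa using φ.map_rot_flip (Γ.rot.symm h) (by rwa [Γ.vert_rot_symm])

/-- The isomorphism of bubbled blowups given by an equivalence of ribbon graphs: flipping a vertex
interchanges the two sides of the matching edges of its half-edges. -/
def blowupIso : Γ.bubbledBlowup.Iso Γ'.bubbledBlowup where
  onEdge := φ.onHalf
  onFree := (φ.onLoop.prodCongr (Equiv.refl Bool)).subtypeEquiv fun c => by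
    simp [φ.map_loopTwist]
  flip h := φ.flip (Γ.vert h)
  map_join := by
    rintro ⟨h, _ | _, b⟩
    · cases hf : φ.flip (Γ.vert h)
      · cases b <;> simp [relabelSides, bubbledBlowup, bubbleJoin, Γ.vert_rot, Γ.vert_rot_symm,
          hf, φ.map_rot h hf, φ.map_rot_symm hf]
      · cases b <;> simp [relabelSides, bubbledBlowup, bubbleJoin, Γ.vert_rot, Γ.vert_rot_symm,
          hf, φ.rot_onHalf_flip hf, φ.map_rot_symm_flip hf]
    · simp only [relabelSides, Equiv.coe_fn_mk, bubbledBlowup, bubbleJoin, φ.map_opp, φ.map_twist]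
      cases b <;> cases Γ.twist h <;> cases φ.flip (Γ.vert h) <;>
        cases φ.flip (Γ.vert (Γ.opp h)) <;> rfl

theorem stateRel_iff {ν : V → Bool} {ν' : V' → Bool} :
    φ.blowupIso.StateRel (Γ.blowupState ν) (Γ'.blowupState ν') ↔ ∀ v, ν' (φ.onVert v) = ν v := by
  have exists_vert : Function.Surjective Γ.vert := Γ.exists_vert_eq
  rw [exists_vert.forall]
  simp only [Iso.StateRel, blowupState, ← φ.map_vert]
  rfl

/-- The monomials `x` and `x'` over vertex states correspond to each other. -/
def VertexMonomialRel {n : ℕ} (x : Γ.VertexMonomial n) (x' : Γ'.VertexMonomial n) : Prop :=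
  φ.blowupIso.MonomialRel (Γ.toBlowup n x) (Γ'.toBlowup n x')

theorem exists_onVertexMonomial (n : ℕ) :
    ∃ B : Γ.VertexMonomial n ≃ Γ'.VertexMonomial n, ∀ x, φ.VertexMonomialRel x (B x) := by
  refine exists_equiv_of_rel ⟨fun x => ?_, fun x' => ?_⟩ ⟨fun _ _ _ hx hy => ?_,
    fun _ _ _ hx hy => ?_⟩
  · have h : φ.blowupIso.StateRel (Γ.blowupState x.1) (Γ'.blowupState (x.1 ∘ φ.onVert.symm)) :=
      φ.stateRel_iff.2 fun v => by simp
    exact ⟨⟨_, _⟩, h.monomialRel_symm x.2⟩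
  · have h : φ.blowupIso.StateRel (Γ.blowupState (x'.1 ∘ φ.onVert)) (Γ'.blowupState x'.1) :=
      φ.stateRel_iff.2 fun v => rfl
    exact ⟨⟨_, _⟩, h.monomialRel x'.2⟩
  · exact Γ.toBlowup_injective n (Iso.biUnique_monomialRel.1 hx hy)
  · exact Γ'.toBlowup_injective n (Iso.biUnique_monomialRel.2 hx hy)

end BlowupIso

section VertexMap

variable {φ : Γ.Equivalence Γ'} {n : ℕ}

namespace VertexMonomialRel

variable {x : Γ.VertexMonomial n} {x' : Γ'.VertexMonomial n}

theorem apply_onVert (h : φ.VertexMonomialRel x x') (v : V) : x'.1 (φ.onVert v) = x.1 v :=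
  φ.stateRel_iff.1 h.1 v

theorem weight_eq (h : φ.VertexMonomialRel x x') : weight x'.1 = weight x.1 :=
  (Nat.card_congr (φ.onVert.subtypeEquiv fun v => by rw [h.apply_onVert])).symm

theorem homDegree_eq (h : φ.VertexMonomialRel x x') : Γ'.homDegree x' = Γ.homDegree x := by
  rw [homDegree, homDegree, h.weight_eq]

theorem edgeSign_eq (h : φ.VertexMonomialRel x x') {N : ℕ} (o : V' ≃ Fin N) (v : V) :
    edgeSign o x'.1 (φ.onVert v) = edgeSign (φ.onVert.trans o) x.1 v := by
  rw [edgeSign, edgeSign]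
  congr 1
  exact (Nat.card_congr (φ.onVert.subtypeEquiv fun u => by rw [h.apply_onVert]; rfl)).symm

theorem qDegree_eq [Finite H] [Finite L] [Finite H'] [Finite L'] (h : φ.VertexMonomialRel x x') :
    Γ'.qDegree x' = Γ.qDegree x := by
  rw [TrivalentRibbonGraph.qDegree_eq, TrivalentRibbonGraph.qDegree_eq, h.weight_eq,
    Iso.MonomialRel.degree_eq h]

end VertexMonomialRel

theorem map_star_perm [Finite H] [Finite H'] (φ : Γ.Equivalence Γ') (v : V) :
    ((Γ.star v).map φ.blowupIso.onEdge).Perm (Γ'.star (φ.onVert v)) := by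
  refine Γ'.perm_star ((Γ.nodup_star v).map φ.onHalf.injective) (fun h hh => ?_) rfl
  obtain ⟨a, ha, rfl⟩ := List.mem_map.1 hh
  exact (φ.map_vert a).trans (congrArg φ.onVert (Γ.mem_star.1 ha))

variable {k : Type*} [CommRing k] {B : Γ.VertexMonomial n ≃ Γ'.VertexMonomial n}

theorem extend_comp (hB : ∀ x, φ.VertexMonomialRel x (B x))
    {C : Γ.bubbledBlowup.Monomial n ≃ Γ'.bubbledBlowup.Monomial n}
    (hC : ∀ x, φ.blowupIso.MonomialRel x (C x)) (w : Γ'.VertexMonomial n → k) :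
    Function.extend (Γ.toBlowup n) (w ∘ B) 0 = Function.extend (Γ'.toBlowup n) w 0 ∘ C := by
  have comm (x) : C (Γ.toBlowup n x) = Γ'.toBlowup n (B x) :=
    Iso.biUnique_monomialRel.2 (hC _) (hB x)
  funext y
  rw [Function.comp_apply]
  by_cases hy : ∃ x, Γ.toBlowup n x = y
  · obtain ⟨x, rfl⟩ := hy
    rw [(Γ.toBlowup_injective n).extend_apply, comm, (Γ'.toBlowup_injective n).extend_apply,
      Function.comp_apply]
  · rw [Function.extend_apply' _ _ _ hy, Function.extend_apply']
    · rfl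
    · rintro ⟨z, hz⟩
      rw [← B.apply_symm_apply z, ← comm] at hz
      exact hy ⟨_, C.injective hz⟩

theorem vertexMap_comp [Finite H] [Finite L] [Finite H'] [Finite L'] (hn : 0 < n) {s : k}
    (hs : s ^ 2 = n) (hB : ∀ x, φ.VertexMonomialRel x (B x)) (v : V) (w : Γ'.VertexMonomial n → k) :
    Γ.vertexMap n s v (w ∘ B) = Γ'.vertexMap n s (φ.onVert v) w ∘ B := by
  obtain ⟨C, hC⟩ := φ.blowupIso.exists_onMonomial n
  funext y
  rw [Function.comp_apply, vertexMap_apply, vertexMap_apply, extend_comp hB hC,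
    Iso.edgeMapList_comp s hC, Function.comp_apply,
    edgeMapList_perm _ hn hs (φ.map_star_perm v), Iso.biUnique_monomialRel.2 (hC _) (hB y)]

end VertexMap

end Equivalence

section Homology

variable [Fintype V] [Finite H] [Finite L] [Fintype V'] [Finite H'] [Finite L'] {k : Type*}
  [CommRing k] {n : ℕ} {N N' : ℕ}

theorem nonempty_VCH_equiv_of_chain_equiv (s : k) (o : V ≃ Fin N) (o' : V' ≃ Fin N')
    (Φ : (Γ'.VertexMonomial n → k) ≃ₗ[k] (Γ.VertexMonomial n → k))
    (mem_chain : ∀ i j w, Φ w ∈ Γ.chain n k i j ↔ w ∈ Γ'.chain n k i j)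
    (comm : ∀ w, Γ.differential n s o (Φ w) = Φ (Γ'.differential n s o' w)) (i j : ℤ) :
    Nonempty (Γ.VCH n s o i j ≃ₗ[k] Γ'.VCH n s o' i j) := by
  have cocycles_eq : (Γ'.cocycles n s o' i j).map (Φ : _ →ₗ[k] _) = Γ.cocycles n s o i j := by
    ext w
    obtain ⟨w, rfl⟩ := Φ.surjective w
    rw [Submodule.mem_map_equiv, LinearEquiv.symm_apply_apply, cocycles, cocycles,
      Submodule.mem_inf, Submodule.mem_inf, mem_chain, LinearMap.mem_ker, LinearMap.mem_ker, comm,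
      LinearEquiv.map_eq_zero_iff]
  have mem_coboundaries (w) :
      Φ w ∈ Γ.coboundaries n s o i j ↔ w ∈ Γ'.coboundaries n s o' i j := by
    rw [coboundaries, coboundaries, Submodule.mem_map, Submodule.mem_map, Φ.surjective.exists]
    simp only [mem_chain, comm, Φ.injective.eq_iff]
  refine ⟨(Submodule.Quotient.equiv _ _ (LinearEquiv.ofSubmodules Φ _ _ cocycles_eq) ?_).symm⟩
  ext w
  obtain ⟨w, rfl⟩ := (LinearEquiv.ofSubmodules Φ _ _ cocycles_eq).surjective w
  rw [Submodule.mem_map_equiv, LinearEquiv.symm_apply_apply]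
  exact (mem_coboundaries w.1).symm

theorem nonempty_VCH_equiv_of_numberings (Γ : TrivalentRibbonGraph V H L) (s : k) (o : V ≃ Fin N)
    (o' : V ≃ Fin N') (i j : ℤ) : Nonempty (Γ.VCH n s o i j ≃ₗ[k] Γ.VCH n s o' i j) := by
  classical
  let ε := inversionSign o o'
  have involutive : Function.Involutive (Γ.scale k n ε) := fun w => by
    funext x
    rw [scale_scale, scale_apply, inversionSign_mul_self, one_smul]
  refine nonempty_VCH_equiv_of_chain_equiv s o o' (LinearEquiv.ofInvolutive _ involutive)
    (fun i j w => ⟨fun h => ?_, Γ.scale_mem_chain ε⟩) (fun w => ?_) i j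
  · exact involutive w ▸ Γ.scale_mem_chain ε h
  · rw [LinearEquiv.coe_ofInvolutive, differential_apply, differential_apply, map_sum]
    refine Finset.sum_congr rfl fun v _ => ?_
    rw [Γ.scale_vertexMap s fun ν hν => inversionSign_update o o' hν, scale_scale, scale_scale]
    congr 3
    funext ν
    rw [mul_assoc, mul_assoc, edgeSign_mul_self, mul_one, mul_comm]

namespace Equivalence

theorem nonempty_VCH_equiv_trans (φ : Γ.Equivalence Γ') (hn : 0 < n) {s : k} (hs : s ^ 2 = n)
    (o' : V' ≃ Fin N') (i j : ℤ) :
    Nonempty (Γ.VCH n s (φ.onVert.trans o') i j ≃ₗ[k] Γ'.VCH n s o' i j) := by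
  obtain ⟨B, hB⟩ := φ.exists_onVertexMonomial n
  refine nonempty_VCH_equiv_of_chain_equiv s _ o' (LinearEquiv.funCongrLeft k k B)
    (fun i j w => ?_) (fun w => ?_) i j
  · change (∀ x, _ → w (B x) = 0) ↔ ∀ x, _ → w x = 0
    simp only [B.surjective.forall, (hB _).homDegree_eq, (hB _).qDegree_eq]
  · change Γ.differential n s _ (w ∘ B) = Γ'.differential n s o' w ∘ B
    funext x
    rw [differential_apply, Function.comp_apply, differential_apply, Finset.sum_apply,
      Finset.sum_apply]
    refine Fintype.sum_equiv φ.onVert _ _ fun v => ?_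
    refine Eq.trans (congrArg (fun w => Γ.vertexMap n s v w x) ?_)
      (congrFun (vertexMap_comp hn hs hB v _) x)
    funext y
    simp only [scale_apply, Function.comp_apply, (hB y).edgeSign_eq]

theorem nonempty_VCH_equiv (φ : Γ.Equivalence Γ') (hn : 0 < n) {s : k} (hs : s ^ 2 = n)
    (o : V ≃ Fin N) (o' : V' ≃ Fin N') (i j : ℤ) :
    Nonempty (Γ.VCH n s o i j ≃ₗ[k] Γ'.VCH n s o' i j) := by
  obtain ⟨f⟩ := Γ.nonempty_VCH_equiv_of_numberings s o (φ.onVert.trans o') i j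
  obtain ⟨g⟩ := φ.nonempty_VCH_equiv_trans hn hs o' i j
  exact ⟨f.trans g⟩

end Equivalence

end Homology

end TrivalentRibbonGraph

/-! ## Euler characteristics -/

section AdditiveRank

universe u w

variable {k : Type u} [CommRing k]

namespace IsFiniteFreeSubquotient

section

variable {M M' : Type*} [AddCommGroup M] [Module k M] [AddCommGroup M'] [Module k M']

theorem of_surjective (h : IsFiniteFreeSubquotient k M) (f : M →ₗ[k] M')
    (hf : Function.Surjective f) : IsFiniteFreeSubquotient k M' := by
  obtain ⟨r, N, g, hg⟩ := h
  exact ⟨r, N, f ∘ₗ g, hf.comp hg⟩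

theorem submodule (h : IsFiniteFreeSubquotient k M) (P : Submodule k M) :
    IsFiniteFreeSubquotient k P := by
  obtain ⟨r, N, f, hf⟩ := h
  have hfP : Function.Surjective (f.restrict fun _ hx => hx : P.comap f →ₗ[k] P) := by
    rintro ⟨y, hy⟩
    obtain ⟨x, rfl⟩ := hf y
    exact ⟨⟨x, hy⟩, rfl⟩
  exact ⟨r, (P.comap f).map N.subtype,
    (f.restrict fun _ hx => hx : P.comap f →ₗ[k] P) ∘ₗ (N.equivSubtypeMap _).symm.toLinearMap,
    hfP.comp (LinearEquiv.surjective _)⟩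

end

theorem pi (c : ℕ) : IsFiniteFreeSubquotient k (Fin c → k) :=
  ⟨c, ⊤, Submodule.subtype ⊤, fun x => ⟨⟨x, trivial⟩, rfl⟩⟩

theorem rank_lt_aleph0 [IsDomain k] {M : Type u} [AddCommGroup M] [Module k M]
    (h : IsFiniteFreeSubquotient k M) : Module.rank k M < Cardinal.aleph0 := by
  obtain ⟨r, N, f, hf⟩ := h
  calc Module.rank k M ≤ Module.rank k N := LinearMap.rank_le_of_surjective f hf
    _ ≤ Module.rank k (Fin r → k) := N.rank_le
    _ = r := rank_fin_fun r
    _ < Cardinal.aleph0 := Cardinal.natCast_lt_aleph0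

end IsFiniteFreeSubquotient

namespace AdditiveRank

variable {A : Type w} [AddCommGroup A] (r : AdditiveRank k A)

theorem rank_of_subsingleton (M : Type u) [AddCommGroup M] [Module k M] [Subsingleton M] :
    r.rank M = 0 := by
  have h := r.additive M M M LinearMap.id 0 Function.injective_id
    (fun x => ⟨fun _ => ⟨x, rfl⟩, fun _ => Subsingleton.elim _ _⟩)
    (fun x => ⟨0, Subsingleton.elim _ _⟩)
    ⟨0, ⊤, 0, fun x => ⟨0, Subsingleton.elim _ _⟩⟩
  simpa using h

theorem rank_congr {M M' : Type u} [AddCommGroup M] [Module k M] [AddCommGroup M'] [Module k M']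
    (h : IsFiniteFreeSubquotient k M') (e : M ≃ₗ[k] M') : r.rank M' = r.rank M := by
  have := r.additive M M' PUnit.{u + 1} e.toLinearMap 0 e.injective
    (fun x => ⟨fun _ => e.surjective x, fun _ => rfl⟩) (fun x => ⟨0, rfl⟩) h
  rwa [r.rank_of_subsingleton PUnit, add_zero] at this

theorem rank_pi (c : ℕ) : r.rank (Fin c → k) = c • r.rank k := by
  induction c with
  | zero => rw [r.rank_of_subsingleton, zero_smul]
  | succ c ih =>
    have exact : Function.Exact (LinearMap.single k (fun _ : Fin (c + 1) => k) 0)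
        (LinearMap.funLeft k k Fin.succ) := fun x => by
      refine ⟨fun hx => ⟨x 0, funext fun i => ?_⟩, ?_⟩
      · cases i using Fin.cases with
        | zero => simp
        | succ i => simpa using (congrFun hx i).symm
      · rintro ⟨a, rfl⟩
        funext i
        simp
    rw [r.additive _ _ _ _ _ (Pi.single_injective (M := fun _ => k) 0) exact
      (LinearMap.funLeft_surjective_of_injective _ _ _ (Fin.succ_injective c)) (.pi _), ih,
      succ_nsmul']

theorem rank_eq_add_rank_quotient {M : Type u} [AddCommGroup M] [Module k M]
    (h : IsFiniteFreeSubquotient k M) (P : Submodule k M) :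
    r.rank M = r.rank P + r.rank (M ⧸ P) :=
  r.additive P M (M ⧸ P) P.subtype P.mkQ P.injective_subtype (LinearMap.exact_subtype_mkQ P)
    P.mkQ_surjective h

/-- The usual rank of modules over an integral domain as an additive rank function. -/
noncomputable def finrank (k : Type u) [CommRing k] [IsDomain k] : AdditiveRank k ℤ where
  rank M := Module.finrank k M
  additive M₁ M₂ M₃ _ _ _ _ _ _ f g hf hfg hg h := by
    have rank_add : Module.rank k M₃ + Module.rank k M₁ = Module.rank k M₂ := by
      rw [← LinearMap.rank_range_add_rank_ker g, LinearMap.exact_iff.1 hfg,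
        rank_range_of_injective f hf, LinearMap.range_eq_top.2 hg, rank_top]
    have rank_lt := h.rank_lt_aleph0
    rw [← rank_add] at rank_lt
    rw [Module.finrank, ← rank_add, Cardinal.toNat_add (self_le_add_right _ _ |>.trans_lt rank_lt)
      (self_le_add_left _ _ |>.trans_lt rank_lt), Nat.cast_add, add_comm, Module.finrank,
      Module.finrank]

end AdditiveRank

end AdditiveRank

theorem sum_range_alternating_add {A : Type*} [AddCommGroup A] (b : ℕ → A) (N : ℕ) :
    ∑ i ∈ Finset.range N, (-1 : ℤ) ^ i • (b i + b (i + 1)) = b 0 - (-1 : ℤ) ^ N • b N := by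
  induction N with
  | zero => simp
  | succ N ih =>
    rw [Finset.sum_range_succ, ih, pow_succ, smul_add, mul_neg_one, neg_smul]
    abel

theorem prod_laurent_T {R ι : Type*} [CommSemiring R] (t : Finset ι) (f : ι → ℤ) :
    ∏ i ∈ t, (LaurentPolynomial.T (f i) : R[T;T⁻¹]) = LaurentPolynomial.T (∑ i ∈ t, f i) := by
  classical
  induction t using Finset.induction_on with
  | empty => simp
  | insert a t ha ih =>
    rw [Finset.prod_insert ha, Finset.sum_insert ha, ih, LaurentPolynomial.T_add]

namespace TrivalentRibbonGraph

variable {V H L : Type}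

theorem weight_le {N : ℕ} (o : V ≃ Fin N) (ν : V → Bool) : weight ν ≤ N :=
  have := Finite.of_equiv _ o.symm
  (Finite.card_subtype_le _).trans_eq (Nat.card_eq_of_equiv_fin o)

section

variable (Γ : TrivalentRibbonGraph V H L) [Finite H] [Finite L] (n : ℕ)

/-- The number of monomials of bidegree `(i, j)`, which form a basis of `C_n^{i,j}(Γ)`. -/
noncomputable def bidegreeCard (i j : ℤ) : ℕ :=
  Nat.card {x : Γ.VertexMonomial n // Γ.homDegree x = i ∧ Γ.qDegree x = j}

theorem exists_chain_equiv [Finite V] (k : Type*) [CommRing k] (i j : ℤ) :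
    Nonempty (Γ.chain n k i j ≃ₗ[k] (Fin (Γ.bidegreeCard n i j) → k)) := by
  classical
  refine ⟨(LinearEquiv.ofBijective ((LinearMap.funLeft k k (Subtype.val :
    {x : Γ.VertexMonomial n // Γ.homDegree x = i ∧ Γ.qDegree x = j} → _)).domRestrict _)
      ⟨?_, fun g => ?_⟩).trans (LinearEquiv.funCongrLeft k k (Finite.equivFin _).symm)⟩
  · rintro ⟨w, hw⟩ ⟨w', hw'⟩ h
    refine Subtype.ext (funext fun x => ?_)
    by_cases hx : Γ.homDegree x = i ∧ Γ.qDegree x = j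
    · exact congrFun h ⟨x, hx⟩
    · exact (hw x hx).trans (hw' x hx).symm
  · exact ⟨⟨fun x => if h : Γ.homDegree x = i ∧ Γ.qDegree x = j then g ⟨x, h⟩ else 0,
      fun x hx => dif_neg hx⟩, funext fun x => dif_pos x.2⟩

theorem chain_eq_bot (k : Type*) [CommRing k] {i : ℤ} {N : ℕ} (o : V ≃ Fin N)
    (hi : i < 0 ∨ N < i) (j : ℤ) : Γ.chain n k i j = ⊥ := by
  refine (Submodule.eq_bot_iff _).2 fun w hw => funext fun x => hw x ?_
  rintro ⟨h, -⟩
  have := weight_le o x.1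
  rw [homDegree] at h
  omega

theorem isFiniteFreeSubquotient_chain [Finite V] (k : Type*) [CommRing k] (i j : ℤ) :
    IsFiniteFreeSubquotient k (Γ.chain n k i j) := by
  obtain ⟨e⟩ := Γ.exists_chain_equiv n k i j
  exact (IsFiniteFreeSubquotient.pi _).of_surjective e.symm.toLinearMap e.symm.surjective

end

section EulerCharacteristic

universe u w

variable (Γ : TrivalentRibbonGraph V H L) [Fintype V] [Finite H] [Finite L] {n : ℕ}
  {k : Type u} [CommRing k] {s : k} {N : ℕ} (o : V ≃ Fin N)

theorem coboundaries_le_chain (s : k) (i j : ℤ) : Γ.coboundaries n s o i j ≤ Γ.chain n k i j := by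
  rw [coboundaries, Submodule.map_le_iff_le_comap]
  intro w hw
  have := Γ.differential_mem_chain o s hw
  rwa [sub_add_cancel] at this

theorem coboundaries_le_cocycles (hn : 0 < n) (hs : s ^ 2 = n) (i j : ℤ) :
    Γ.coboundaries n s o i j ≤ Γ.cocycles n s o i j :=
  le_inf (Γ.coboundaries_le_chain o s i j)
    (Submodule.map_le_iff_le_comap.2 fun w _ => Γ.differential_differential o hn hs w)

theorem coboundaries_eq_bot (s : k) {i : ℤ} (hi : i ≤ 0 ∨ N < i) (j : ℤ) :
    Γ.coboundaries n s o i j = ⊥ := by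
  rcases hi with hi | hi
  · rw [coboundaries, Γ.chain_eq_bot n k o (.inl (by omega)), Submodule.map_bot]
  · rw [eq_bot_iff, ← Γ.chain_eq_bot n k o (.inr hi) j]
    exact Γ.coboundaries_le_chain o s i j

theorem coboundaries_add_one (s : k) (i j : ℤ) :
    Γ.coboundaries n s o (i + 1) j = (Γ.chain n k i j).map (Γ.differential n s o) := by
  rw [coboundaries, add_sub_cancel_right]

theorem isFiniteFreeSubquotient_cocycles (s : k) (i j : ℤ) :
    IsFiniteFreeSubquotient k (Γ.cocycles n s o i j) :=
  ((Γ.isFiniteFreeSubquotient_chain n k i j).submodule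
    ((Γ.cocycles n s o i j).submoduleOf _)).of_surjective
      (Submodule.submoduleOfEquivOfLe inf_le_left).toLinearMap (LinearEquiv.surjective _)

theorem isFiniteFreeSubquotient_coboundaries (s : k) (i j : ℤ) :
    IsFiniteFreeSubquotient k (Γ.coboundaries n s o i j) :=
  (Γ.isFiniteFreeSubquotient_chain n k (i - 1) j).of_surjective _
    (LinearMap.submoduleMap_surjective _ _)

section Rank

variable {A : Type w} [AddCommGroup A] (r : AdditiveRank k A)

theorem rank_chain (s : k) (i j : ℤ) : r.rank (Γ.chain n k i j) =
    r.rank (Γ.cocycles n s o i j) + r.rank (Γ.coboundaries n s o (i + 1) j) := by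
  rw [coboundaries_add_one]
  refine r.additive _ _ _ (Submodule.inclusion inf_le_left)
    ((Γ.differential n s o).submoduleMap _) (Submodule.inclusion_injective _) ?_
    (LinearMap.submoduleMap_surjective _ _) (Γ.isFiniteFreeSubquotient_chain n k i j)
  rintro ⟨w, hw⟩
  constructor
  · intro h
    exact ⟨⟨w, hw, congrArg Subtype.val h⟩, rfl⟩
  · rintro ⟨⟨w', hw'⟩, h⟩
    obtain rfl : w' = w := congrArg Subtype.val h
    exact Subtype.ext hw'.2

theorem rank_cocycles (hn : 0 < n) (hs : s ^ 2 = n) (i j : ℤ) : r.rank (Γ.cocycles n s o i j) =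
    r.rank (Γ.coboundaries n s o i j) + r.rank (Γ.VCH n s o i j) := by
  rw [r.rank_eq_add_rank_quotient (Γ.isFiniteFreeSubquotient_cocycles o s i j)
      ((Γ.coboundaries n s o i j).submoduleOf (Γ.cocycles n s o i j)),
    r.rank_congr (M := (Γ.coboundaries n s o i j).submoduleOf (Γ.cocycles n s o i j))
      (Γ.isFiniteFreeSubquotient_coboundaries o s i j)
      (Submodule.submoduleOfEquivOfLe (Γ.coboundaries_le_cocycles o hn hs i j))]

theorem rank_coboundaries_eq_zero (s : k) {i : ℤ} (hi : i ≤ 0 ∨ N < i) (j : ℤ) :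
    r.rank (Γ.coboundaries n s o i j) = 0 :=
  have := (Submodule.subsingleton_iff_eq_bot).2 (Γ.coboundaries_eq_bot (n := n) o s hi j)
  r.rank_of_subsingleton _

theorem sum_rank_VCH (hn : 0 < n) (hs : s ^ 2 = n) (j : ℤ) :
    ∑ i ∈ Finset.range (N + 1), (-1 : ℤ) ^ i • r.rank (Γ.VCH n s o i j) =
      ∑ i ∈ Finset.range (N + 1), (-1 : ℤ) ^ i • r.rank (Γ.chain n k i j) := by
  let b (i : ℕ) : A := r.rank (Γ.coboundaries n s o i j)
  have b_zero : b 0 = 0 := Γ.rank_coboundaries_eq_zero o r s (.inl le_rfl) j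
  have b_top : b (N + 1) = 0 := Γ.rank_coboundaries_eq_zero o r s (.inr (by omega)) j
  have rank_chain_eq (i : ℕ) :
      r.rank (Γ.chain n k i j) = r.rank (Γ.VCH n s o i j) + (b i + b (i + 1)) := by
    rw [Γ.rank_chain o r s, Γ.rank_cocycles o r hn hs, ← Nat.cast_succ]
    abel
  simp only [rank_chain_eq, smul_add _ (r.rank _), Finset.sum_add_distrib,
    sum_range_alternating_add, b_zero, b_top, smul_zero, sub_zero, add_zero]

end Rank

theorem vertexPolynomial_eq_sum [Fintype (Γ.VertexMonomial n)] : Γ.vertexPolynomial n =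
    ∑ x : Γ.VertexMonomial n, (-1 : ℤ) ^ weight x.1 • LaurentPolynomial.T (Γ.qDegree x) := by
  classical
  let _ := fun ν => Fintype.ofFinite (Γ.StateCircle ν)
  have term_eq (ν : V → Bool) :
      (-LaurentPolynomial.T (3 * (n / 2 : ℕ) : ℤ)) ^ weight ν *
          loopPolynomial n ^ Nat.card (Γ.StateCircle ν) =
        ∑ a : Γ.StateCircle ν → Fin n,
          (-1 : ℤ) ^ weight ν • (LaurentPolynomial.T (Γ.qDegree ⟨ν, a⟩) : ℤ[T;T⁻¹]) := by
    rw [Nat.card_eq_fintype_card, loopPolynomial, ← Fin.sum_univ_eq_sum_range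
      (fun a => (LaurentPolynomial.T ((n / 2 : ℕ) - a : ℤ) : ℤ[T;T⁻¹])),
      ← Finset.card_univ, ← Finset.prod_const, Fintype.prod_sum, Finset.mul_sum]
    refine Finset.sum_congr rfl fun a _ => ?_
    rw [prod_laurent_T, neg_pow, LaurentPolynomial.T_pow, mul_assoc, ← LaurentPolynomial.T_add,
      zsmul_eq_mul, mul_comm (weight ν : ℤ), add_comm]
    push_cast
    rfl
  calc Γ.vertexPolynomial n
      = ∑ ν : V → Bool, (-LaurentPolynomial.T (3 * (n / 2 : ℕ) : ℤ)) ^ weight ν *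
          loopPolynomial n ^ Nat.card (Γ.StateCircle ν) := by
        simp [vertexPolynomial, vertexBracket, weight]
    _ = ∑ ν, ∑ a : Γ.StateCircle ν → Fin n,
          (-1 : ℤ) ^ weight ν • LaurentPolynomial.T (Γ.qDegree ⟨ν, a⟩) :=
        Finset.sum_congr rfl fun ν _ => term_eq ν
    _ = _ := by
        rw [← Fintype.sum_sigma' fun ν (a : Γ.StateCircle ν → Fin n) =>
          (-1 : ℤ) ^ weight ν • (LaurentPolynomial.T (Γ.qDegree ⟨ν, a⟩) : ℤ[T;T⁻¹])]
        congr!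

theorem coeff_vertexPolynomial (o : V ≃ Fin N) (j : ℤ) : (Γ.vertexPolynomial n).coeff j =
    ∑ i ∈ Finset.range (N + 1), (-1 : ℤ) ^ i * (Γ.bidegreeCard n i j : ℤ) := by
  classical
  have := Fintype.ofFinite (Γ.VertexMonomial n)
  have card_eq (i : ℕ) : (-1 : ℤ) ^ i * (Γ.bidegreeCard n i j : ℤ) =
      ∑ x : Γ.VertexMonomial n, if weight x.1 = i then
        (-1 : ℤ) ^ weight x.1 * (if Γ.qDegree x = j then 1 else 0) else 0 := by
    rw [bidegreeCard, Nat.card_eq_fintype_card, Fintype.card_subtype, Finset.card_filter,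
      Nat.cast_sum, Finset.mul_sum]
    refine Finset.sum_congr rfl fun x _ => ?_
    rw [homDegree]
    by_cases hi : weight x.1 = i <;> by_cases hj : Γ.qDegree x = j <;> simp [hi, hj]
  simp only [card_eq]
  rw [Finset.sum_comm, vertexPolynomial_eq_sum, AddMonoidAlgebra.coeff_sum,
    Finsupp.finsetSum_apply]
  refine Finset.sum_congr rfl fun x _ => ?_
  rw [Finset.sum_ite_eq, if_pos (Finset.mem_range.2 (Nat.lt_succ_of_le (weight_le o x.1))),
    AddMonoidAlgebra.coeff_smul, Finsupp.smul_apply, LaurentPolynomial.T_apply, smul_eq_mul]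

theorem eulerCharacteristic (hn : 0 < n) (hs : s ^ 2 = n) {A : Type w} [AddCommGroup A]
    (r : AdditiveRank k A) (j : ℤ) :
    ∑ i ∈ Finset.range (N + 1), (-1 : ℤ) ^ i • r.rank (Γ.VCH n s o i j) =
      (Γ.vertexPolynomial n).coeff j • r.rank k := by
  rw [Γ.sum_rank_VCH o r hn hs, Γ.coeff_vertexPolynomial o, Finset.sum_smul]
  refine Finset.sum_congr rfl fun i _ => ?_
  obtain ⟨e⟩ := Γ.exists_chain_equiv n k i j
  rw [← r.rank_congr (.pi _) e, r.rank_pi, mul_smul, natCast_zsmul]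

end EulerCharacteristic

end TrivalentRibbonGraph

theorem theorem1 {V H L : Type} [Fintype V] [Finite H] [Finite L]
    (Γ : TrivalentRibbonGraph V H L) (n : ℕ) (hn : 0 < n)
    {k : Type*} [CommRing k] (s : k) (hs : s ^ 2 = (n : k)) {N : ℕ} (o : V ≃ Fin N) :
    -- the three-step composites are independent of the order of the three steps
    (∀ (v : V) (h₁ h₂ h₃ : H), Γ.vert h₁ = v → Γ.vert h₂ = v → Γ.vert h₃ = v →
      h₁ ≠ h₂ → h₁ ≠ h₃ → h₂ ≠ h₃ → Γ.threeStep n s h₁ h₂ h₃ = Γ.vertexMap n s v) ∧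
    -- the differential has bidegree `(1, 0)` and square zero
    (∀ (i j : ℤ), ∀ w ∈ Γ.chain n k i j, Γ.differential n s o w ∈ Γ.chain n k (i + 1) j) ∧
    Γ.differential n s o ∘ₗ Γ.differential n s o = 0 ∧
    -- the homology depends neither on the numbering of the vertices nor on the presentation
    (∀ {V' H' L' : Type} [Fintype V'] [Finite H'] [Finite L']
      (Γ' : TrivalentRibbonGraph V' H' L') {N' : ℕ} (o' : V' ≃ Fin N'),
      Nonempty (Γ.Equivalence Γ') →
        ∀ i j : ℤ, Nonempty (Γ.VCH n s o i j ≃ₗ[k] Γ'.VCH n s o' i j)) ∧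
    -- over a domain, the graded Euler characteristic, coefficient by coefficient
    (IsDomain k → ∀ j : ℤ,
      ∑ i ∈ Finset.range (N + 1), (-1 : ℤ) ^ i * (Module.finrank k (Γ.VCH n s o i j) : ℤ) =
        (Γ.vertexPolynomial n).coeff j) ∧
    -- over any ring, the graded Euler characteristic with respect to any additive rank
    (∀ {A : Type*} [AddCommGroup A] (r : AdditiveRank k A) (j : ℤ),
      ∑ i ∈ Finset.range (N + 1), (-1 : ℤ) ^ i • r.rank (Γ.VCH n s o i j) =
        (Γ.vertexPolynomial n).coeff j • r.rank k) := by
  refine ⟨fun v h₁ h₂ h₃ hv₁ hv₂ hv₃ h12 h13 h23 =>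
      Γ.threeStep_eq_vertexMap hn hs hv₁ hv₂ hv₃ h12 h13 h23,
    fun i j w hw => Γ.differential_mem_chain o s hw,
    LinearMap.ext fun w => Γ.differential_differential o hn hs w,
    fun Γ' N' o' ⟨φ⟩ i j => φ.nonempty_VCH_equiv hn hs o o' i j,
    fun _ j => ?_, fun r j => Γ.eulerCharacteristic o hn hs r j⟩
  have h := Γ.eulerCharacteristic o hn hs (AdditiveRank.finrank k) j
  simpa [AdditiveRank.finrank] using h
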